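/- Let $1\le n_r<n_t$, let $H\in\mathbb C^{n_r\times n_t}$ have rank $n_r$, put $G=H^*H$ and $S(G,x)=x^*Gx$, and let $\lambda_1,\dots,\lambda_{n_t}$ be the eigenvalues of $G$ (with multiplicity), $3\delta=\min_{\lambda_l\ne\lambda_r}|\lambda_l-\lambda_r|$, $\|G\|$ the spectral norm. For $l<j$ let $R_{l,j}(\theta,\phi)$ be the unitary matrix that agrees with the identity except for the entries $R_{ll}=R_{jj}=\cos\theta$, $R_{jl}=e^{-i\phi}\sin\theta$, $R_{lj}=-e^{i\phi}\sin\theta$, and let $r_{l,j}(\theta,\phi)$ be its $l$-th column. Let $m=n_t(n_t-1)/2$ and let $(l_k,j_k)_{k\ge1}$ be the $m$-periodic sequence that runs in each sweep $qm+1,\dots,(q+1)m$ through the pairs $l<j$ in lexicographic order. The Blind Null Space Learning algorithm (BNSL) with line search accuracy $\eta$ starts from $W_0=I$ and, in stage $k\ge1$, observing only values $f_k(S(G,x))$ for a continuous strictly increasing $f_k:[0,\infty)\to[0,\infty)$, chooses $\hat\phi_k\in[-\pi,\pi]$ at distance at most $\eta$ from a minimum point of $\phi\mapsto f_k(S(G,W_{k-1}r_{l_k,j_k}(\pi/3,\phi)))$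 on $[-\pi,\pi]$, then $\tilde\theta_k\in[-\pi/2,\pi/2]$ at distance at most $\eta$ from a minimum point of $\theta\mapsto f_k(S(G,W_{k-1}r_{l_k,j_k}(\theta,\hat\phi_k)))$ on $[-\pi/2,\pi/2]$, sets $\hat\theta_k=\tilde\theta_k$ if $|\tilde\theta_k|\le\pi/4$ and $\hat\theta_k=\tilde\theta_k-\operatorname{sign}(\tilde\theta_k)\pi/2$ otherwise, and puts $W_k=W_{k-1}R_{l_k,j_k}(\hat\theta_k,\hat\phi_k)$. Let $A_k=W_{k-1}^*GW_{k-1}$ and let $P_k$ be the Euclidean norm of the strictly upper triangular part of $A_k$. There are constants $C>0$ and $\eta_0>0$ that depend only on $n_t$ and $n_r$ such that the following holds for all $H$, $f_k$, all $0\le\eta\le\eta_0$, every run of BNSL and every $k\ge1$. Suppose that $P_k^2<\delta^2/8$ and that either the eigenvalues of $G$ are all distinct, or a sweep starts at stage $k$ (that is, $m\mid k-1$) and, for each eigenvalue $\lambda$ of $G$, the positions $i$ of the diagonal entries of $A_k$ with $|(A_k)_{ii}-\lambda|\le\delta/2$ are consecutive (as when the entries that belong to a multiple eigenvalue $0$ come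 last and the nonzero eigenvalues are simple). Then $$P_{k+m}^2\le C\Big(\frac{P_k^2}{\delta}\Big)^2+C\,\frac{\eta P_k^{3/2}}{\delta}+C\,\frac{\eta^2P_k^{1/2}}{\delta}+2\,(2n_tn_r-n_r^2-n_r)\,\eta^2\|G\|^2 .$$ -/

import Mathlib

namespace BNSL

open Matrix

/-- The complex rotation `R_{l,m}(θ, φ)`: the identity except in rows and columns `l`, `m`, where
`R l l = R m m = cos θ`, `R m l = e^{-iφ} sin θ` and `R l m = -e^{iφ} sin θ`. -/
noncomputable def rot {n : ℕ} (l m : Fin n) (θ φ : ℝ) : Matrix (Fin n) (Fin n) ℂ :=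
  Matrix.of fun p q =>
    if p = q then (if p = l ∨ p = m then (Real.cos θ : ℂ) else 1)
    else if p = m ∧ q = l then Complex.exp (-(Complex.I * φ)) * (Real.sin θ : ℂ)
    else if p = l ∧ q = m then -(Complex.exp (Complex.I * φ) * (Real.sin θ : ℂ))
    else 0

/-- The `l`-th column `r_{l,m}(θ, φ)` of `R_{l,m}(θ, φ)`. -/
noncomputable def rotCol {n : ℕ} (l m : Fin n) (θ φ : ℝ) : Fin n → ℂ :=
  fun p => rot l m θ φ p l

/-- The quadratic form `S(G, x) = x^* G x` (a real number when `G` is Hermitian). -/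
noncomputable def quadForm {n : ℕ} (G : Matrix (Fin n) (Fin n) ℂ) (x : Fin n → ℂ) : ℝ :=
  (star x ⬝ᵥ (G *ᵥ x)).re

/-- The length of a sweep: the number `n (n - 1) / 2` of pairs `l < m`. -/
def sweepLength (n : ℕ) : ℕ := n * (n - 1) / 2

/-- `J 1, J 2, …` is the row-cyclic pivot sequence: it is periodic, the period being one sweep, and
the pairs `l < m` of a sweep come in strictly increasing lexicographic order. As there are exactly
`sweepLength n` such pairs, each is used once per sweep. -/
structure IsRowCyclic {n : ℕ} (J : ℕ → Fin n × Fin n) : Prop where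
  pair_lt : ∀ k, 1 ≤ k → (J k).1 < (J k).2
  periodic : ∀ k, 1 ≤ k → J (k + sweepLength n) = J k
  increasing : ∀ k q, 1 ≤ k → k < q → q ≤ sweepLength n →
    (J k).1 < (J q).1 ∨ ((J k).1 = (J q).1 ∧ (J k).2 < (J q).2)

/-- `z` is a possible outcome of a line search of accuracy `η` for the minimum of `w` on `[a, b]`:
a point of `[a, b]` at distance at most `η` from a minimum point of `w` on `[a, b]`. -/
def IsLineSearch (w : ℝ → ℝ) (a b η z : ℝ) : Prop :=
  z ∈ Set.Icc a b ∧ ∃ z₀ ∈ Set.Icc a b, IsMinOn w (Set.Icc a b) z₀ ∧ |z - z₀| ≤ η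

/-- The reduction of an angle of `[-π/2, π/2]` to `[-π/4, π/4]` by a shift by `π/2`. -/
noncomputable def innerAngle (t : ℝ) : ℝ :=
  if |t| ≤ Real.pi / 4 then t
  else t - (if 0 < t then 1 else -1) * (Real.pi / 2)

/-- The function `f : [0, ∞) → [0, ∞)` is continuous and strictly increasing. -/
def IsObservation (f : ℝ → ℝ) : Prop :=
  Set.MapsTo f (Set.Ici 0) (Set.Ici 0) ∧ StrictMonoOn f (Set.Ici 0) ∧
    ContinuousOn f (Set.Ici 0)

/-- `W 0, W 1, …` are precoding matrices produced by the blind null space learning algorithm on `G`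
with line search accuracy `η`, where in stage `k` only the values `f k (S(G, x))` are observed. -/
structure IsRun {n : ℕ} (G : Matrix (Fin n) (Fin n) ℂ) (f : ℕ → ℝ → ℝ) (η : ℝ)
    (J : ℕ → Fin n × Fin n) (W : ℕ → Matrix (Fin n) (Fin n) ℂ) : Prop where
  init : W 0 = 1
  step : ∀ k, 1 ≤ k → ∃ φ θ : ℝ,
    IsLineSearch
      (fun x => f k (quadForm G (W (k - 1) *ᵥ rotCol (J k).1 (J k).2 (Real.pi / 3) x)))
      (-Real.pi) Real.pi η φ ∧
    IsLineSearch
      (fun x => f k (quadForm G (W (k - 1) *ᵥ rotCol (J k).1 (J k).2 x φ)))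
      (-(Real.pi / 2)) (Real.pi / 2) η θ ∧
    W k = W (k - 1) * rot (J k).1 (J k).2 (innerAngle θ) φ

/-- The matrix `A_k = W_{k-1}^* G W_{k-1}` of stage `k ≥ 1`. -/
noncomputable def iterate {n : ℕ} (G : Matrix (Fin n) (Fin n) ℂ)
    (W : ℕ → Matrix (Fin n) (Fin n) ℂ) (k : ℕ) : Matrix (Fin n) (Fin n) ℂ :=
  (W (k - 1))ᴴ * G * W (k - 1)

/-- The (Euclidean) norm of the strictly upper triangular part of a matrix. -/
noncomputable def offNorm {n : ℕ} (A : Matrix (Fin n) (Fin n) ℂ) : ℝ :=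
  Real.sqrt (∑ i : Fin n, ∑ j : Fin n, if i < j then ‖A i j‖ ^ 2 else 0)

/-- The spectral norm of a square matrix. -/
noncomputable def specNorm {n : ℕ} (G : Matrix (Fin n) (Fin n) ℂ) : ℝ :=
  ‖Matrix.toEuclideanCLM (n := Fin n) (𝕜 := ℂ) G‖

/-- The set of the distances between distinct values of `ev`. -/
def gaps {n : ℕ} (ev : Fin n → ℝ) : Set ℝ :=
  {x | ∃ i j, ev i ≠ ev j ∧ x = |ev i - ev j|}

/-- The positions `i` whose diagonal entry is affiliated with (that is, within `δ / 2` of) one and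
the same eigenvalue are consecutive. -/
def AffiliationConsecutive {n : ℕ} (ev : Fin n → ℝ) (δ : ℝ)
    (A : Matrix (Fin n) (Fin n) ℂ) : Prop :=
  ∀ i j p q : Fin n, i ≤ j → j ≤ p →
    |(A i i).re - ev q| ≤ δ / 2 → |(A p p).re - ev q| ≤ δ / 2 → |(A j j).re - ev q| ≤ δ / 2

end BNSL

namespace BNSL

open Matrix Finset
open scoped ComplexOrder

variable {n : ℕ}

/-! Each stage is an inexact complex Jacobi rotation. As `f k` is strictly increasing, a line search
locates minima of S itself. The phase and angle objectives are sinusoids, so accuracy η leaves a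
pivot entry of square at most η²(Δ² + 5|a|²), where Δ is the difference of the two diagonal entries
and a the old pivot entry (`IsApproxRotation.pivot_sq_le`). A rotation changes P² only through the
pivot entry, so P² grows during a sweep by at most the sum R of these residuals.

For quadratic convergence, group the positions by the eigenvalue close to their diagonal entry.
Entries inside a class are O(P²/δ) because of the spectral gap alone, whatever the rotations did
(`IsDiagonalizedBy.norm_apply_le_of_same`). A pivot between two classes has an angle O(P/δ + η), so
it disturbs the places already processed by O(P²/δ + ηP) only. A pivot inside a class may turn by a
large angle; but if the classes are intervals and the order is row-cyclic, it mixes processed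
cross-class places only with processed ones and preserves their total weight. If the eigenvalues are
simple, such pivots do not occur, and the sweep may start anywhere. So the square root of the
cross-class weight after a sweep is at most O(P²/δ + ηP) + √(2R) (`sqrt_maskedSq_processed_le`).

The factor of η²‖G‖² comes from R: each pair is a pivot once, and Σ Δ² over all pairs is at most
(2nr − r² − r)/2 · ‖G‖², because the diagonal entries lie in [0, ‖G‖] and sum to at most r‖G‖
(`sum_sq_sub_le`).

This perturbative argument needs P and η‖G‖ to be at most cδ with a small c. Otherwise either P² is
below c⁻²(P²/δ)², or P is below η‖G‖, and the slow growth of P² suffices. The first and the last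
term of the bound thus already dominate. -/

/-- The sum of the squared absolute values of the entries of `A` at the places in `D`. -/
noncomputable def maskedSq (D : Fin n → Fin n → Prop) (A : Matrix (Fin n) (Fin n) ℂ) : ℝ :=
  open Classical in ∑ i, ∑ j, if D i j then ‖A i j‖ ^ 2 else 0

/-! ### Algebra of the complex rotations -/

theorem mul_rot_left {l j : Fin n} (hlj : l ≠ j) (θ φ : ℝ) (A : Matrix (Fin n) (Fin n) ℂ)
    (i : Fin n) :
    (A * rot l j θ φ) i l
      = A i l * Real.cos θ + A i j * (Complex.exp (-(Complex.I * φ)) * Real.sin θ) := by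
  rw [Matrix.mul_apply, ← Finset.sum_subset (Finset.subset_univ {l, j}), Finset.sum_pair hlj]
  · simp [rot, hlj.symm]
  · intro x _ hx
    simp only [Finset.mem_insert, Finset.mem_singleton, not_or] at hx
    simp [rot, hx.1, hx.2]

theorem mul_rot_right {l j : Fin n} (hlj : l ≠ j) (θ φ : ℝ) (A : Matrix (Fin n) (Fin n) ℂ)
    (i : Fin n) :
    (A * rot l j θ φ) i j
      = A i l * (-(Complex.exp (Complex.I * φ) * Real.sin θ)) + A i j * Real.cos θ := by
  rw [Matrix.mul_apply, ← Finset.sum_subset (Finset.subset_univ {l, j}), Finset.sum_pair hlj]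
  · simp [rot, hlj, hlj.symm]
  · intro x _ hx
    simp only [Finset.mem_insert, Finset.mem_singleton, not_or] at hx
    simp [rot, hx.1, hx.2]

theorem mul_rot_other {l j : Fin n} (θ φ : ℝ) (A : Matrix (Fin n) (Fin n) ℂ)
    (i : Fin n) {x : Fin n} (hl : x ≠ l) (hj : x ≠ j) :
    (A * rot l j θ φ) i x = A i x := by
  rw [Matrix.mul_apply, Finset.sum_eq_single x]
  · simp [rot, hl, hj]
  · intro y _ hy
    simp [rot, hl, hj, hy]
  · simp

theorem exp_neg_eq_conj (φ : ℝ) :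
    Complex.exp (-(Complex.I * φ)) = (starRingEnd ℂ) (Complex.exp (Complex.I * φ)) := by
  rw [← Complex.exp_conj]
  simp

theorem exp_mul_conj_exp (φ : ℝ) :
    Complex.exp (Complex.I * φ) * (starRingEnd ℂ) (Complex.exp (Complex.I * φ)) = 1 := by
  rw [← exp_neg_eq_conj, ← Complex.exp_add]
  simp

theorem normSq_rot_add (a b : ℂ) (θ φ : ℝ) :
    ‖a * Real.cos θ + b * (Complex.exp (-(Complex.I * φ)) * Real.sin θ)‖ ^ 2
      + ‖a * (-(Complex.exp (Complex.I * φ) * Real.sin θ)) + b * Real.cos θ‖ ^ 2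
      = ‖a‖ ^ 2 + ‖b‖ ^ 2 := by
  have h1 : ∀ z : ℂ, ((‖z‖ ^ 2 : ℝ) : ℂ) = z * (starRingEnd ℂ) z := fun z => by
    rw [Complex.mul_conj, Complex.normSq_eq_norm_sq]
  have hu := exp_mul_conj_exp φ
  have hc : (Real.cos θ : ℂ) ^ 2 + (Real.sin θ : ℂ) ^ 2 = 1 := by
    exact_mod_cast Real.cos_sq_add_sin_sq θ
  apply Complex.ofReal_injective
  rw [Complex.ofReal_add, Complex.ofReal_add, h1, h1, h1, h1, exp_neg_eq_conj]
  simp only [map_add, map_mul, map_neg, Complex.conj_ofReal, Complex.conj_conj]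
  generalize Complex.exp (Complex.I * φ) = u at *
  generalize (starRingEnd ℂ) u = v at *
  linear_combination (a * (starRingEnd ℂ) a + b * (starRingEnd ℂ) b) * hc
    + (a * (starRingEnd ℂ) a + b * (starRingEnd ℂ) b) * (Real.sin θ : ℂ) ^ 2 * hu

/-- In each row the rotation acts on the entries in columns `l`, `j` by a unitary 2×2 map, and the
mask sees both of them or neither. -/
theorem maskedSq_mul_rot {l j : Fin n} (hlj : l ≠ j) (θ φ : ℝ) (A : Matrix (Fin n) (Fin n) ℂ)
    (D : Fin n → Fin n → Prop) (hD : ∀ i, D i l ↔ D i j) :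
    maskedSq D (A * rot l j θ φ) = maskedSq D A := by
  classical
  unfold maskedSq
  refine Finset.sum_congr rfl fun i _ => ?_
  have key : ∀ B : Matrix (Fin n) (Fin n) ℂ, (∑ x, if D i x then ‖B i x‖ ^ 2 else 0)
      = (if D i l then ‖B i l‖ ^ 2 + ‖B i j‖ ^ 2 else 0)
        + ∑ x ∈ univ \ {l, j}, if D i x then ‖B i x‖ ^ 2 else 0 := by
    intro B
    rw [← Finset.sum_sdiff (Finset.subset_univ {l, j}), Finset.sum_pair hlj, add_comm]
    congr 1
    by_cases h : D i l
    · simp [h, (hD i).1 h]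
    · simp [h, mt (hD i).2 h]
  rw [key, key, mul_rot_left hlj, mul_rot_right hlj, normSq_rot_add]
  congr 1
  refine Finset.sum_congr rfl fun x hx => ?_
  simp only [mem_sdiff, mem_univ, mem_insert, mem_singleton, not_or, true_and] at hx
  rw [mul_rot_other θ φ A i hx.1 hx.2]

theorem maskedSq_conjTranspose (D : Fin n → Fin n → Prop) (hD : ∀ i j, D i j ↔ D j i)
    (A : Matrix (Fin n) (Fin n) ℂ) : maskedSq D Aᴴ = maskedSq D A := by
  classical
  unfold maskedSq
  rw [Finset.sum_comm]
  refine Finset.sum_congr rfl fun i _ => Finset.sum_congr rfl fun x _ => ?_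
  simp [Matrix.conjTranspose_apply, hD x i]

/-- Conjugation by a rotation preserves the weight of a symmetric set of places in which the two
pivot indices play the same role. -/
theorem maskedSq_conj_rot {l j : Fin n} (hlj : l ≠ j) (θ φ : ℝ) (A : Matrix (Fin n) (Fin n) ℂ)
    (D : Fin n → Fin n → Prop) (hsymm : ∀ i j, D i j ↔ D j i) (hD : ∀ i, D i l ↔ D i j) :
    maskedSq D ((rot l j θ φ)ᴴ * A * rot l j θ φ) = maskedSq D A := by
  rw [maskedSq_mul_rot hlj _ _ _ _ hD, ← maskedSq_conjTranspose D hsymm, conjTranspose_mul,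
    conjTranspose_conjTranspose, maskedSq_mul_rot hlj _ _ _ _ hD, maskedSq_conjTranspose D hsymm]

theorem conjTranspose_rot_mul_rot {l j : Fin n} (hlj : l ≠ j) (θ φ : ℝ) :
    (rot l j θ φ)ᴴ * rot l j θ φ = 1 := by
  have hu := exp_mul_conj_exp φ
  have hc : (Real.cos θ : ℂ) ^ 2 + (Real.sin θ : ℂ) ^ 2 = 1 := by
    exact_mod_cast Real.cos_sq_add_sin_sq θ
  ext p q
  by_cases hql : q = l
  · subst hql
    rw [mul_rot_left hlj]
    by_cases hpl : p = q
    · subst hpl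
      simp only [conjTranspose_apply, rot, of_apply, exp_neg_eq_conj]
      simp [hlj, hlj.symm, -Complex.ofReal_cos, -Complex.ofReal_sin]
      linear_combination hc + (Real.sin θ : ℂ) ^ 2 * hu
    by_cases hpj : p = j
    · subst hpj
      simp only [conjTranspose_apply, rot, of_apply, exp_neg_eq_conj]
      simp [hlj, hlj.symm, -Complex.ofReal_cos, -Complex.ofReal_sin]
      ring
    · simp [rot, hpl, hpj, Ne.symm hpl, Ne.symm hpj, conjTranspose_apply]
  by_cases hqj : q = j
  · subst hqj
    rw [mul_rot_right hlj]
    by_cases hpl : p = l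
    · subst hpl
      simp only [conjTranspose_apply, rot, of_apply, exp_neg_eq_conj]
      simp [hlj, hlj.symm, -Complex.ofReal_cos, -Complex.ofReal_sin]
      ring
    by_cases hpj : p = q
    · subst hpj
      simp only [conjTranspose_apply, rot, of_apply, exp_neg_eq_conj]
      simp [hlj, hlj.symm, -Complex.ofReal_cos, -Complex.ofReal_sin]
      linear_combination hc + (Real.sin θ : ℂ) ^ 2 * hu
    · simp [rot, hpl, hpj, Ne.symm hpl, Ne.symm hpj, conjTranspose_apply]
  · rw [mul_rot_other θ φ _ _ hql hqj]
    by_cases hpq : p = q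
    · subst hpq
      simp [rot, hql, hqj, conjTranspose_apply]
    · simp [rot, hql, hqj, hpq, Ne.symm hpq, conjTranspose_apply]

theorem conj_rot_apply_other {l j : Fin n} (θ φ : ℝ) (A : Matrix (Fin n) (Fin n) ℂ)
    {i x : Fin n} (hil : i ≠ l) (hij : i ≠ j) (hxl : x ≠ l) (hxj : x ≠ j) :
    ((rot l j θ φ)ᴴ * A * rot l j θ φ) i x = A i x := by
  rw [mul_rot_other _ _ _ _ hxl hxj, ← conjTranspose_conjTranspose ((rot l j θ φ)ᴴ * A),
    conjTranspose_apply, conjTranspose_mul, conjTranspose_conjTranspose,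
    mul_rot_other _ _ _ _ hil hij, conjTranspose_apply, star_star]

theorem conj_rot_mul_apply_left {l j : Fin n} (hlj : l ≠ j) (θ φ : ℝ)
    (A : Matrix (Fin n) (Fin n) ℂ) (x : Fin n) :
    ((rot l j θ φ)ᴴ * A) l x
      = A l x * Real.cos θ + A j x * (Complex.exp (Complex.I * φ) * Real.sin θ) := by
  rw [← conjTranspose_conjTranspose ((rot l j θ φ)ᴴ * A),
    conjTranspose_apply, conjTranspose_mul, conjTranspose_conjTranspose,
    mul_rot_left hlj, exp_neg_eq_conj]
  simp [conjTranspose_apply, -Complex.ofReal_cos, -Complex.ofReal_sin]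

theorem conj_rot_mul_apply_right {l j : Fin n} (hlj : l ≠ j) (θ φ : ℝ)
    (A : Matrix (Fin n) (Fin n) ℂ) (x : Fin n) :
    ((rot l j θ φ)ᴴ * A) j x
      = A l x * (-(Complex.exp (-(Complex.I * φ)) * Real.sin θ)) + A j x * Real.cos θ := by
  rw [← conjTranspose_conjTranspose ((rot l j θ φ)ᴴ * A),
    conjTranspose_apply, conjTranspose_mul, conjTranspose_conjTranspose,
    mul_rot_right hlj, exp_neg_eq_conj]
  simp [conjTranspose_apply, -Complex.ofReal_cos, -Complex.ofReal_sin]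

/-- The `(l, l)` entry after a rotation. -/
theorem conj_rot_apply_left_left {l j : Fin n} (hlj : l ≠ j) (θ φ : ℝ)
    {A : Matrix (Fin n) (Fin n) ℂ} (hA : A.IsHermitian) :
    (((rot l j θ φ)ᴴ * A * rot l j θ φ) l l).re
      = (A l l).re * Real.cos θ ^ 2 + (A j j).re * Real.sin θ ^ 2
        + 2 * (Real.sin θ * Real.cos θ) * (A l j * Complex.exp (-(Complex.I * φ))).re := by
  have h := hA.apply j l
  rw [mul_rot_left hlj, conj_rot_mul_apply_left hlj, conj_rot_mul_apply_left hlj, ← h,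
    exp_neg_eq_conj]
  have hu := exp_mul_conj_exp φ
  generalize Complex.exp (Complex.I * φ) = u at *
  have hu1 := congrArg Complex.re hu
  simp only [Complex.mul_re, Complex.mul_im, Complex.conj_re, Complex.conj_im, Complex.add_re,
    Complex.add_im, Complex.ofReal_re, Complex.ofReal_im, Complex.star_def, Complex.one_re] at *
  linear_combination (A j j).re * Real.sin θ ^ 2 * hu1

/-- The squared absolute value of the pivot entry after a rotation. -/
theorem norm_conj_rot_apply_pivot {l j : Fin n} (hlj : l ≠ j) (θ φ : ℝ)
    {A : Matrix (Fin n) (Fin n) ℂ} (hA : A.IsHermitian) :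
    ‖((rot l j θ φ)ᴴ * A * rot l j θ φ) l j‖ ^ 2
      = (((A j j).re - (A l l).re) * (Real.sin θ * Real.cos θ)
          + (A l j * Complex.exp (-(Complex.I * φ))).re * (Real.cos θ ^ 2 - Real.sin θ ^ 2)) ^ 2
        + (A l j * Complex.exp (-(Complex.I * φ))).im ^ 2 := by
  have hu := exp_mul_conj_exp φ
  have hc : (Real.cos θ : ℂ) ^ 2 + (Real.sin θ : ℂ) ^ 2 = 1 := by
    exact_mod_cast Real.cos_sq_add_sin_sq θ
  have hl : A l l = ((A l l).re : ℂ) := (hA.coe_re_apply_self l).symm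
  have hj : A j j = ((A j j).re : ℂ) := (hA.coe_re_apply_self j).symm
  have h := hA.apply j l
  set γ := A l j * Complex.exp (-(Complex.I * φ)) with hγ
  -- Up to the phase `exp (I * φ)`, the real part is half the θ-derivative of the (l, l) entry, and
  -- the imaginary part does not depend on θ. This is why minimizing S nearly annihilates the pivot.
  have key : ((rot l j θ φ)ᴴ * A * rot l j θ φ) l j = Complex.exp (Complex.I * φ) *
      (((((A j j).re - (A l l).re) * (Real.sin θ * Real.cos θ)
        + γ.re * (Real.cos θ ^ 2 - Real.sin θ ^ 2) : ℝ) : ℂ) + γ.im * Complex.I) := by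
    have e1 : ∀ γ : ℂ, ((((A j j).re - (A l l).re) * (Real.sin θ * Real.cos θ)
        + γ.re * (Real.cos θ ^ 2 - Real.sin θ ^ 2) : ℝ) : ℂ) + γ.im * Complex.I
        = (A j j - A l l) * (Real.sin θ * Real.cos θ) + Real.cos θ ^ 2 * γ
          - Real.sin θ ^ 2 * (starRingEnd ℂ) γ := by
      rintro ⟨x, y⟩
      have hg : (starRingEnd ℂ) (⟨x, y⟩ : ℂ) = x - y * Complex.I := by
        apply Complex.ext <;> simp
      rw [hl, hj, hg, Complex.mk_eq_add_mul_I]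
      push_cast [-Complex.ofReal_cos, -Complex.ofReal_sin]
      simp only [Complex.add_re, Complex.add_im, Complex.mul_re, Complex.mul_im, Complex.ofReal_re,
        Complex.ofReal_im, Complex.I_re, Complex.I_im]
      simp [-Complex.ofReal_cos, -Complex.ofReal_sin]
      linear_combination -(y * Complex.I) * hc
    rw [e1, mul_rot_right hlj, conj_rot_mul_apply_left hlj, conj_rot_mul_apply_left hlj, ← h,
      hγ, exp_neg_eq_conj]
    simp only [map_mul, Complex.conj_conj, Complex.star_def]
    generalize Complex.exp (Complex.I * φ) = u at *
    generalize (starRingEnd ℂ) u = v at *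
    linear_combination (-A l j * Real.cos θ ^ 2) * hu
  rw [key, norm_mul, mul_comm Complex.I, Complex.norm_exp_ofReal_mul_I, one_mul,
    ← Complex.normSq_eq_norm_sq, Complex.normSq_add_mul_I]

/-! ### Line searches and near-critical angles -/

/-- A minimum point on a closed interval of the length of a period is a global one, hence
critical. -/
theorem hasDerivAt_eq_zero_of_isMinOn_of_periodic {w : ℝ → ℝ} {a T z w' : ℝ} (hT : 0 < T)
    (hw : Function.Periodic w T) (hmin : IsMinOn w (Set.Icc a (a + T)) z)
    (hd : HasDerivAt w w' z) : w' = 0 := by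
  refine IsLocalMin.hasDerivAt_eq_zero (Filter.Eventually.of_forall fun x => ?_) hd
  obtain ⟨y, hy, hxy⟩ := hw.exists_mem_Ico hT x a
  rw [hxy]
  exact hmin (Set.Ico_subset_Icc_self hy)

/-- Removes the unknown observation: from here on only the quadratic form matters. Nonnegativity
keeps its values where `f` is monotone. -/
theorem isMinOn_of_comp_strictMonoOn {f w : ℝ → ℝ} {s : Set ℝ} {z : ℝ}
    (hf : StrictMonoOn f (Set.Ici 0)) (hw : ∀ x, 0 ≤ w x)
    (h : IsMinOn (fun x => f (w x)) s z) : IsMinOn w s z := by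
  intro x hx
  exact (hf.le_iff_le (hw z) (hw x)).1 (h hx)

/-- Near a minimum point of the phase search, the imaginary part of the rotated pivot entry is
small. -/
theorem abs_im_le_of_phase_search {a : ℂ} {c d η φ : ℝ} (hd : 0 < d)
    (h : ∃ z ∈ Set.Icc (-Real.pi) Real.pi,
      IsMinOn (fun x : ℝ => c + d * (a * Complex.exp (-(Complex.I * x))).re)
        (Set.Icc (-Real.pi) Real.pi) z ∧ |φ - z| ≤ η) :
    |(a * Complex.exp (-(Complex.I * φ))).im| ≤ ‖a‖ * η := by
  obtain ⟨z, -, hmin, hz⟩ := h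
  have he : ∀ x : ℝ, Complex.exp (-(Complex.I * x)) = Real.cos x - Real.sin x * Complex.I := by
    intro x
    have : -(Complex.I * x) = ((-x : ℝ) : ℂ) * Complex.I := by push_cast; ring
    rw [this, Complex.exp_ofReal_mul_I]
    push_cast
    simp [sub_eq_add_neg]
  have hre : ∀ x : ℝ, (a * Complex.exp (-(Complex.I * x))).re
      = a.re * Real.cos x + a.im * Real.sin x := by
    intro x
    rw [he]
    simp [Complex.mul_re, -Complex.ofReal_cos, -Complex.ofReal_sin]
  have him : ∀ x : ℝ, (a * Complex.exp (-(Complex.I * x))).im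
      = a.im * Real.cos x - a.re * Real.sin x := by
    intro x
    rw [he]
    simp [Complex.mul_im, -Complex.ofReal_cos, -Complex.ofReal_sin]
    ring
  have h0 : d * (a.im * Real.cos z - a.re * Real.sin z) = 0 := by
    refine hasDerivAt_eq_zero_of_isMinOn_of_periodic (a := -Real.pi) (T := 2 * Real.pi)
      (w := fun x : ℝ => c + d * (a * Complex.exp (-(Complex.I * x))).re) (z := z)
      (by positivity) ?_ ?_ ?_
    · intro x
      simp only [hre, Real.cos_add_two_pi, Real.sin_add_two_pi]
    · rwa [show -Real.pi + 2 * Real.pi = Real.pi by ring]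
    · simp only [hre]
      have := (((Real.hasDerivAt_cos z).const_mul a.re).add
        ((Real.hasDerivAt_sin z).const_mul a.im)).const_mul d |>.const_add c
      refine this.congr_deriv ?_
      ring
  have h1 : a.im * Real.cos z - a.re * Real.sin z = 0 := by
    rcases mul_eq_zero.1 h0 with h | h
    · exact absurd h hd.ne'
    · exact h
  -- The imaginary part is, up to `d`, the derivative of the objective. It vanishes at `z`, so at
  -- `φ` only the sine of the offset `φ - z` remains.
  have h2 : (a * Complex.exp (-(Complex.I * φ))).im
      = -((a.re * Real.cos z + a.im * Real.sin z) * Real.sin (φ - z)) := by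
    rw [him, Real.sin_sub]
    have e1 : Real.cos φ = Real.cos (φ - z) * Real.cos z - Real.sin (φ - z) * Real.sin z := by
      rw [← Real.cos_add]; ring_nf
    have e2 : Real.sin φ = Real.sin (φ - z) * Real.cos z + Real.cos (φ - z) * Real.sin z := by
      rw [← Real.sin_add]; ring_nf
    rw [← Real.sin_sub, e1, e2]
    linear_combination Real.cos (φ - z) * h1
  have h3 : |a.re * Real.cos z + a.im * Real.sin z| ≤ ‖a‖ := by
    rw [← hre]
    refine (Complex.abs_re_le_norm _).trans ?_
    rw [norm_mul, show -(Complex.I * (z : ℂ)) = ((-z : ℝ) : ℂ) * Complex.I by push_cast; ring,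
      Complex.norm_exp_ofReal_mul_I, mul_one]
  rw [h2, abs_neg, abs_mul]
  exact mul_le_mul h3 ((Real.abs_sin_le_abs).trans hz) (abs_nonneg _) (norm_nonneg _)

theorem innerAngle_cases {t : ℝ} :
    (innerAngle t = t) ∨ (Real.sin (innerAngle t) = Real.cos t ∧
      Real.cos (innerAngle t) = -Real.sin t) ∨ (Real.sin (innerAngle t) = -Real.cos t ∧
      Real.cos (innerAngle t) = Real.sin t) := by
  unfold innerAngle
  split_ifs with h1 h2
  · exact Or.inl rfl
  · refine Or.inr (Or.inr ⟨?_, ?_⟩)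
    · rw [one_mul, Real.sin_sub_pi_div_two]
    · rw [one_mul, Real.cos_sub_pi_div_two]
  · refine Or.inr (Or.inl ⟨?_, ?_⟩)
    · rw [neg_one_mul, sub_neg_eq_add, Real.sin_add_pi_div_two]
    · rw [neg_one_mul, sub_neg_eq_add, Real.cos_add_pi_div_two]

theorem abs_innerAngle_le {t : ℝ} (ht : t ∈ Set.Icc (-(Real.pi / 2)) (Real.pi / 2)) :
    |innerAngle t| ≤ Real.pi / 4 := by
  unfold innerAngle
  split_ifs with h1 h2
  · exact h1
  · rw [abs_of_pos h2] at h1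
    rw [abs_le]
    constructor <;> linarith [ht.2, Real.pi_pos]
  · rw [abs_of_nonpos (not_lt.1 h2)] at h1
    rw [abs_le]
    constructor <;> linarith [ht.1, Real.pi_pos]

/-- Near a minimum point of the angle search, also after the reduction to the inner angle, the
derivative of the objective is small. -/
theorem abs_deriv_le_of_angle_search {x y β η t : ℝ}
    (h : ∃ z ∈ Set.Icc (-(Real.pi / 2)) (Real.pi / 2),
      IsMinOn (fun θ : ℝ => x * Real.cos θ ^ 2 + y * Real.sin θ ^ 2
          + 2 * (Real.sin θ * Real.cos θ) * β)
        (Set.Icc (-(Real.pi / 2)) (Real.pi / 2)) z ∧ |t - z| ≤ η) :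
    ((y - x) * (Real.sin (innerAngle t) * Real.cos (innerAngle t))
      + β * (Real.cos (innerAngle t) ^ 2 - Real.sin (innerAngle t) ^ 2)) ^ 2
      ≤ η ^ 2 * ((y - x) ^ 2 + 4 * β ^ 2) := by
  obtain ⟨z, -, hmin, hz⟩ := h
  have h0 : 2 * ((y - x) * (Real.sin z * Real.cos z)
      + β * (Real.cos z ^ 2 - Real.sin z ^ 2)) = 0 := by
    refine hasDerivAt_eq_zero_of_isMinOn_of_periodic (a := -(Real.pi / 2)) (T := Real.pi)
      (w := fun θ : ℝ => x * Real.cos θ ^ 2 + y * Real.sin θ ^ 2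
          + 2 * (Real.sin θ * Real.cos θ) * β) (z := z)
      Real.pi_pos ?_ ?_ ?_
    · intro θ
      simp only [Real.cos_add_pi, Real.sin_add_pi]
      ring
    · rwa [show -(Real.pi / 2) + Real.pi = Real.pi / 2 by ring]
    · have hs := Real.hasDerivAt_sin z
      have hc := Real.hasDerivAt_cos z
      have := (((hc.pow 2).const_mul x).add ((hs.pow 2).const_mul y)).add
        (((hs.mul hc).const_mul 2).mul_const β)
      refine this.congr_deriv ?_
      push_cast
      ring
  have h1 : ((y - x) * (Real.sin t * Real.cos t) + β * (Real.cos t ^ 2 - Real.sin t ^ 2)) ^ 2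
      ≤ η ^ 2 * ((y - x) ^ 2 + 4 * β ^ 2) := by
    have e1 : Real.cos t = Real.cos (t - z) * Real.cos z - Real.sin (t - z) * Real.sin z := by
      rw [← Real.cos_add]; ring_nf
    have e2 : Real.sin t = Real.sin (t - z) * Real.cos z + Real.cos (t - z) * Real.sin z := by
      rw [← Real.sin_add]; ring_nf
    have hS : Real.sin (t - z) ^ 2 ≤ η ^ 2 := by
      rw [← sq_abs]
      exact pow_le_pow_left₀ (abs_nonneg _) (Real.abs_sin_le_abs.trans hz) 2
    have hSC := Real.sin_sq_add_cos_sq (t - z)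
    have hsc := Real.sin_sq_add_cos_sq z
    set S := Real.sin (t - z)
    set C := Real.cos (t - z)
    set s := Real.sin z
    set c := Real.cos z
    set v := (y - x) * (c ^ 2 - s ^ 2) - 4 * β * (s * c) with hv
    have h2 : (y - x) * (Real.sin t * Real.cos t) + β * (Real.cos t ^ 2 - Real.sin t ^ 2)
        = S * C * v := by
      rw [e1, e2, hv]
      linear_combination (C ^ 2 - S ^ 2) / 2 * h0
    have h3 : v ^ 2 ≤ (y - x) ^ 2 + 4 * β ^ 2 := by
      have : v ^ 2 + (2 * ((y - x) * (s * c) + β * (c ^ 2 - s ^ 2))) ^ 2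
          = ((y - x) ^ 2 + 4 * β ^ 2) * (s ^ 2 + c ^ 2) ^ 2 := by rw [hv]; ring
      rw [hsc] at this
      nlinarith [sq_nonneg (2 * ((y - x) * (s * c) + β * (c ^ 2 - s ^ 2)))]
    have h4 : (S * C) ^ 2 ≤ η ^ 2 := by
      have : C ^ 2 ≤ 1 := by nlinarith [sq_nonneg S]
      calc (S * C) ^ 2 = S ^ 2 * C ^ 2 := by ring
        _ ≤ S ^ 2 * 1 := by gcongr
        _ ≤ η ^ 2 := by rwa [mul_one]
    rw [h2, mul_pow]
    exact mul_le_mul h4 h3 (sq_nonneg _) (sq_nonneg _)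
  -- A shift by π/2 only changes the sign of the half-derivative: a maximum of the (l, l) entry is
  -- as good as a minimum for annihilating the pivot.
  rcases innerAngle_cases (t := t) with h | ⟨hs, hc⟩ | ⟨hs, hc⟩
  · rwa [h]
  · rw [hs, hc]
    refine le_trans (le_of_eq ?_) h1
    ring
  · rw [hs, hc]
    refine le_trans (le_of_eq ?_) h1
    ring

theorem abs_sin_le_cos_of_abs_le {θ : ℝ} (h : |θ| ≤ Real.pi / 4) :
    |Real.sin θ| ≤ Real.cos θ := by
  have h1 := abs_le.1 h
  rw [abs_le]
  have key : ∀ s : ℝ, |s| ≤ Real.pi / 4 → Real.sin s ≤ Real.cos s := by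
    intro s hs
    have hs := abs_le.1 hs
    have h1 : Real.sin s ≤ Real.sin (Real.pi / 4) := by
      apply Real.sin_le_sin_of_le_of_le_pi_div_two <;> linarith [Real.pi_pos]
    have h2 : Real.cos (Real.pi / 4) ≤ Real.cos s := by
      rw [← Real.cos_abs s]
      apply Real.cos_le_cos_of_nonneg_of_le_pi (abs_nonneg _) <;> linarith [Real.pi_pos]
    rw [Real.cos_pi_div_four, ← Real.sin_pi_div_four] at h2
    exact h1.trans h2
  constructor
  · have := key (-θ) (by rwa [abs_neg])
    rw [Real.sin_neg, Real.cos_neg] at this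
    linarith
  · exact key θ h

theorem conj_rot_apply_right_right {l j : Fin n} (hlj : l ≠ j) (θ φ : ℝ)
    {A : Matrix (Fin n) (Fin n) ℂ} (hA : A.IsHermitian) :
    (((rot l j θ φ)ᴴ * A * rot l j θ φ) j j).re
      = (A l l).re * Real.sin θ ^ 2 + (A j j).re * Real.cos θ ^ 2
        - 2 * (Real.sin θ * Real.cos θ) * (A l j * Complex.exp (-(Complex.I * φ))).re := by
  have h := hA.apply j l
  rw [mul_rot_right hlj, conj_rot_mul_apply_right hlj, conj_rot_mul_apply_right hlj, ← h,
    exp_neg_eq_conj]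
  have hu := exp_mul_conj_exp φ
  generalize Complex.exp (Complex.I * φ) = u at *
  have hu1 := congrArg Complex.re hu
  simp only [Complex.mul_re, Complex.mul_im, Complex.conj_re, Complex.conj_im, Complex.add_re,
    Complex.add_im, Complex.ofReal_re, Complex.ofReal_im, Complex.star_def, Complex.one_re,
    Complex.neg_re, Complex.neg_im] at *
  linear_combination (A l l).re * Real.sin θ ^ 2 * hu1

/-! ### Approximately annihilating rotations -/

/-- `A'` arises from `A` by a rotation with the pivot `(l, j)` whose phase and inner angle nearly
annihilate the pivot entry. -/
def IsApproxRotation (η : ℝ) (l j : Fin n) (A A' : Matrix (Fin n) (Fin n) ℂ) (θ : ℝ) : Prop :=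
  ∃ φ : ℝ, |θ| ≤ Real.pi / 4 ∧ A' = (rot l j θ φ)ᴴ * A * rot l j θ φ ∧
    |(A l j * Complex.exp (-(Complex.I * φ))).im| ≤ ‖A l j‖ * η ∧
    (((A j j).re - (A l l).re) * (Real.sin θ * Real.cos θ)
      + (A l j * Complex.exp (-(Complex.I * φ))).re * (Real.cos θ ^ 2 - Real.sin θ ^ 2)) ^ 2
      ≤ η ^ 2 * (((A j j).re - (A l l).re) ^ 2
          + 4 * (A l j * Complex.exp (-(Complex.I * φ))).re ^ 2)

theorem quadForm_mulVec_rotCol (G W : Matrix (Fin n) (Fin n) ℂ) (l j : Fin n) (θ φ : ℝ) :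
    quadForm G (W *ᵥ rotCol l j θ φ)
      = (((rot l j θ φ)ᴴ * (Wᴴ * G * W) * rot l j θ φ) l l).re := by
  have h : star (W *ᵥ rotCol l j θ φ) ⬝ᵥ (G *ᵥ (W *ᵥ rotCol l j θ φ))
      = star (rotCol l j θ φ) ⬝ᵥ ((Wᴴ * G * W) *ᵥ rotCol l j θ φ) := by
    rw [star_mulVec, ← dotProduct_mulVec, mulVec_mulVec, mulVec_mulVec, Matrix.mul_assoc]
  rw [quadForm, h, Matrix.mul_assoc (rot l j θ φ)ᴴ]
  rfl

theorem quadForm_nonneg {G : Matrix (Fin n) (Fin n) ℂ} (hG : G.PosSemidef) (x : Fin n → ℂ) :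
    0 ≤ quadForm G x := hG.re_dotProduct_nonneg x

theorem iterate_isHermitian {G : Matrix (Fin n) (Fin n) ℂ} (hG : G.IsHermitian)
    (W : ℕ → Matrix (Fin n) (Fin n) ℂ) (k : ℕ) : (iterate G W k).IsHermitian :=
  isHermitian_conjTranspose_mul_mul _ hG

/-- One stage of the algorithm is an approximately annihilating rotation. -/
theorem IsRun.isApproxRotation {G : Matrix (Fin n) (Fin n) ℂ} (hG : G.PosSemidef) {f : ℕ → ℝ → ℝ}
    (hf : ∀ k, IsObservation (f k)) {η : ℝ} {J : ℕ → Fin n × Fin n} (hJ : IsRowCyclic J)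
    {W : ℕ → Matrix (Fin n) (Fin n) ℂ} (hW : IsRun G f η J W) {k : ℕ} (hk : 1 ≤ k) :
    ∃ θ, IsApproxRotation η (J k).1 (J k).2 (iterate G W k) (iterate G W (k + 1)) θ := by
  obtain ⟨φ, t, ⟨hφ, z, hz, hzmin, hφz⟩, ⟨ht, z', hz', hzmin', htz⟩, hstep⟩ := hW.step k hk
  have hlj : (J k).1 ≠ (J k).2 := (hJ.pair_lt k hk).ne
  have hA := iterate_isHermitian hG.1 W k
  have h1 := isMinOn_of_comp_strictMonoOn (hf k).2.1 (fun x => quadForm_nonneg hG _) hzmin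
  have h2 := isMinOn_of_comp_strictMonoOn (hf k).2.1 (fun x => quadForm_nonneg hG _) hzmin'
  simp only [quadForm_mulVec_rotCol] at h1 h2
  change IsMinOn (fun x => ((_ * iterate G W k * _ : Matrix _ _ ℂ) _ _).re) _ _ at h1
  change IsMinOn (fun x => ((_ * iterate G W k * _ : Matrix _ _ ℂ) _ _).re) _ _ at h2
  simp only [conj_rot_apply_left_left hlj _ _ hA] at h1 h2
  refine ⟨innerAngle t, φ, abs_innerAngle_le ht, ?_, ?_, ?_⟩
  · simp only [iterate, Nat.add_sub_cancel, hstep, conjTranspose_mul, Matrix.mul_assoc]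
  -- The trial angle π/3 enters only through the positivity of this amplitude.
  · refine abs_im_le_of_phase_search (d := 2 * (Real.sin (Real.pi / 3) * Real.cos (Real.pi / 3)))
      ?_ ⟨z, hz, h1, hφz⟩
    rw [Real.sin_pi_div_three, Real.cos_pi_div_three]
    positivity
  · exact abs_deriv_le_of_angle_search ⟨z', hz', h2, htz⟩

theorem abs_re_mul_exp_le (a : ℂ) (φ : ℝ) :
    |(a * Complex.exp (-(Complex.I * φ))).re| ≤ ‖a‖ := by
  refine (Complex.abs_re_le_norm _).trans ?_
  rw [norm_mul, show -(Complex.I * (φ : ℂ)) = ((-φ : ℝ) : ℂ) * Complex.I by push_cast; ring,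
    Complex.norm_exp_ofReal_mul_I, mul_one]

namespace IsApproxRotation

variable {η : ℝ} {l j : Fin n} {A A' : Matrix (Fin n) (Fin n) ℂ} {θ : ℝ}

theorem isHermitian (h : IsApproxRotation η l j A A' θ) (hA : A.IsHermitian) :
    A'.IsHermitian := by
  obtain ⟨φ, -, rfl, -⟩ := h
  exact isHermitian_conjTranspose_mul_mul _ hA

/-- The new pivot splits into the half-derivative, controlled by the angle search, and the imaginary
part, controlled by the phase search; 5 = 4 + 1 collects their shares of the old pivot entry. -/
theorem pivot_sq_le (h : IsApproxRotation η l j A A' θ) (hlj : l ≠ j) (hA : A.IsHermitian) :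
    ‖A' l j‖ ^ 2 ≤ η ^ 2 * (((A j j).re - (A l l).re) ^ 2 + 5 * ‖A l j‖ ^ 2) := by
  obtain ⟨φ, -, rfl, h1, h2⟩ := h
  rw [norm_conj_rot_apply_pivot hlj _ _ hA]
  have h3 := pow_le_pow_left₀ (abs_nonneg _) h1 2
  have h4 := pow_le_pow_left₀ (abs_nonneg _) (abs_re_mul_exp_le (A l j) φ) 2
  rw [sq_abs] at h3 h4
  nlinarith [mul_le_mul_of_nonneg_left h4 (sq_nonneg η)]

/-- The bound for the derivative of the objective at the chosen angle. -/
theorem exists_small (h : IsApproxRotation η l j A A' θ) (hlj : l ≠ j) (hη : 0 ≤ η)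
    (hA : A.IsHermitian) :
    ∃ d β : ℝ, |d| ≤ η * (|(A j j).re - (A l l).re| + 2 * ‖A l j‖) ∧ |β| ≤ ‖A l j‖ ∧
      d = ((A j j).re - (A l l).re) * (Real.sin θ * Real.cos θ)
        + β * (Real.cos θ ^ 2 - Real.sin θ ^ 2) ∧
      (A' l l).re = (A l l).re * Real.cos θ ^ 2 + (A j j).re * Real.sin θ ^ 2
        + 2 * (Real.sin θ * Real.cos θ) * β ∧
      (A' j j).re = (A l l).re * Real.sin θ ^ 2 + (A j j).re * Real.cos θ ^ 2
        - 2 * (Real.sin θ * Real.cos θ) * β := by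
  obtain ⟨φ, -, rfl, h1, h2⟩ := h
  refine ⟨_, _, ?_, abs_re_mul_exp_le (A l j) φ, rfl, conj_rot_apply_left_left hlj _ _ hA,
    conj_rot_apply_right_right hlj _ _ hA⟩
  refine abs_le_of_sq_le_sq ?_ (by positivity)
  refine h2.trans ?_
  have h4 := abs_re_mul_exp_le (A l j) φ
  rw [mul_pow]
  refine mul_le_mul_of_nonneg_left ?_ (sq_nonneg η)
  have h5 := pow_le_pow_left₀ (abs_nonneg _) h4 2
  rw [sq_abs] at h5
  have h6 := sq_abs ((A j j).re - (A l l).re)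
  nlinarith [mul_nonneg (abs_nonneg ((A j j).re - (A l l).re)) (norm_nonneg (A l j))]

theorem abs_sin_le_cos (h : IsApproxRotation η l j A A' θ) :
    |Real.sin θ| ≤ Real.cos θ ∧ 1 / 2 ≤ Real.cos θ := by
  have h1 : |Real.sin θ| ≤ Real.cos θ := by
    obtain ⟨φ, hθ, -⟩ := h
    exact abs_sin_le_cos_of_abs_le hθ
  refine ⟨h1, ?_⟩
  have h2 := Real.sin_sq_add_cos_sq θ
  have h3 := pow_le_pow_left₀ (abs_nonneg _) h1 2
  rw [sq_abs] at h3
  nlinarith [(abs_nonneg _).trans h1]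

/-- Diagonal entries l and j move by opposite amounts. Multiplied by cos θ, this amount equals sin θ
(d + β) with the small half-derivative d, and |sin θ| ≤ cos θ for an inner angle, so no spectral gap
is needed. -/
theorem abs_diag_sub_le (h : IsApproxRotation η l j A A' θ) (hlj : l ≠ j) (hη : 0 ≤ η)
    (hA : A.IsHermitian) (i : Fin n) :
    |(A' i i).re - (A i i).re|
      ≤ ‖A l j‖ + η * (|(A j j).re - (A l l).re| + 2 * ‖A l j‖) := by
  obtain ⟨d, β, hd, hβ, hdβ, hll, hjj⟩ := h.exists_small hlj hη hA
  obtain ⟨hs, hc⟩ := h.abs_sin_le_cos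
  have hsc := Real.sin_sq_add_cos_sq θ
  set s := Real.sin θ
  set c := Real.cos θ
  set Δ := (A j j).re - (A l l).re with hΔ
  have key : |Δ * s ^ 2 + 2 * (s * c) * β|
      ≤ ‖A l j‖ + η * (|Δ| + 2 * ‖A l j‖) := by
    have h1 : c * (Δ * s ^ 2 + 2 * (s * c) * β) = s * (d + β) := by
      rw [hdβ]
      linear_combination s * β * hsc
    have h2 : c * |Δ * s ^ 2 + 2 * (s * c) * β| ≤ c * |d + β| := by
      have h0 : 0 ≤ c := by linarith
      rw [← abs_of_nonneg h0, ← abs_mul, abs_of_nonneg h0, h1, abs_mul]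
      exact mul_le_mul_of_nonneg_right hs (abs_nonneg _)
    have h3 := le_of_mul_le_mul_left h2 (by linarith)
    exact h3.trans ((abs_add_le _ _).trans (by linarith))
  by_cases hil : i = l
  · subst hil
    rw [hll]
    refine le_trans (le_of_eq ?_) key
    congr 1
    rw [hΔ]
    linear_combination (A i i).re * hsc
  by_cases hij : i = j
  · subst hij
    rw [hjj, abs_sub_comm]
    refine le_trans (le_of_eq ?_) key
    congr 1
    rw [hΔ]
    linear_combination -(A i i).re * hsc
  · obtain ⟨φ, -, rfl, -⟩ := h
    rw [conj_rot_apply_other _ _ _ hil hij hil hij, sub_self, abs_zero]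
    exact (abs_nonneg _).trans key

/-- Solve the formula for d for Δ sin θ cos θ and divide by cos θ ≥ 1/2. If the diagonal entries are
well separated, this forces a small angle. -/
theorem abs_mul_abs_sin_le (h : IsApproxRotation η l j A A' θ) (hlj : l ≠ j) (hη : 0 ≤ η)
    (hA : A.IsHermitian) :
    |(A j j).re - (A l l).re| * |Real.sin θ|
      ≤ 2 * ‖A l j‖ + 2 * (η * (|(A j j).re - (A l l).re| + 2 * ‖A l j‖)) := by
  obtain ⟨d, β, hd, hβ, hdβ, -⟩ := h.exists_small hlj hη hA
  obtain ⟨hs, hc⟩ := h.abs_sin_le_cos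
  have hsc := Real.sin_sq_add_cos_sq θ
  set s := Real.sin θ
  set c := Real.cos θ
  set Δ := (A j j).re - (A l l).re
  have h1 : |Δ| * |s| * c = |d - β * (c ^ 2 - s ^ 2)| := by
    rw [← abs_mul, ← abs_of_nonneg (show 0 ≤ c by linarith), ← abs_mul, hdβ,
      abs_of_nonneg (show 0 ≤ c by linarith)]
    congr 1
    ring
  have h2 : |β * (c ^ 2 - s ^ 2)| ≤ ‖A l j‖ := by
    rw [abs_mul]
    have : |c ^ 2 - s ^ 2| ≤ 1 := by
      rw [abs_le]; constructor <;> nlinarith [sq_nonneg s, sq_nonneg c]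
    exact (mul_le_of_le_one_right (abs_nonneg _) this).trans hβ
  have h3 := abs_sub d (β * (c ^ 2 - s ^ 2))
  have h4 : 0 ≤ |Δ| * |s| := by positivity
  nlinarith

/-- Outside the 2×2 pivot block an entry is altered by a multiple cos θ − 1 of itself and a multiple
sin θ of another off-diagonal entry, and |cos θ − 1| ≤ |sin θ|. Hermitian symmetry reduces columns
to rows. -/
theorem norm_apply_sub_le (h : IsApproxRotation η l j A A' θ) (hlj : l ≠ j)
    (hA : A.IsHermitian) {p : ℝ} (hp : ∀ i x, i ≠ x → ‖A i x‖ ≤ p) {i x : Fin n}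
    (hix : ¬ ((i = l ∨ i = j) ∧ (x = l ∨ x = j))) :
    ‖A' i x - A i x‖ ≤ 2 * |Real.sin θ| * p := by
  have hA' := h.isHermitian hA
  have hp0 : 0 ≤ p := (norm_nonneg _).trans (hp l j hlj)
  obtain ⟨hs, hc⟩ := h.abs_sin_le_cos
  have hsc := Real.sin_sq_add_cos_sq θ
  have h1c : |Real.cos θ - 1| ≤ |Real.sin θ| := by
    apply sq_le_sq.1
    have := Real.cos_le_one θ
    nlinarith
  have key : ∀ i x, (i = l ∨ i = j) → x ≠ l → x ≠ j →
      ‖A' i x - A i x‖ ≤ 2 * |Real.sin θ| * p := by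
    obtain ⟨φ, -, rfl, -⟩ := h
    have hexp : ‖Complex.exp (Complex.I * φ)‖ = 1 := by
      rw [mul_comm, Complex.norm_exp_ofReal_mul_I]
    have hexp' : ‖Complex.exp (-(Complex.I * φ))‖ = 1 := by
      rw [exp_neg_eq_conj, Complex.norm_conj, hexp]
    have hcc : ‖((Real.cos θ - 1 : ℝ) : ℂ)‖ ≤ |Real.sin θ| := by
      rwa [Complex.norm_real, Real.norm_eq_abs]
    have hss : ‖(Real.sin θ : ℂ)‖ = |Real.sin θ| := by
      rw [Complex.norm_real, Real.norm_eq_abs]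
    rintro i x (rfl | rfl) hxl hxj
    · rw [mul_rot_other _ _ _ _ hxl hxj, conj_rot_mul_apply_left hlj]
      have e : A i x * (Real.cos θ : ℂ) + A j x * (Complex.exp (Complex.I * φ) * Real.sin θ)
          - A i x = A i x * ((Real.cos θ - 1 : ℝ) : ℂ)
            + A j x * (Complex.exp (Complex.I * φ) * Real.sin θ) := by push_cast; ring
      rw [e]
      refine (norm_add_le _ _).trans ?_
      rw [norm_mul, norm_mul, norm_mul, hexp, hss, one_mul]
      have h1 := mul_le_mul (hp i x (Ne.symm hxl)) hcc (norm_nonneg _) hp0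
      have h2 := mul_le_mul_of_nonneg_right (hp j x (Ne.symm hxj)) (abs_nonneg (Real.sin θ))
      linarith
    · rw [mul_rot_other _ _ _ _ hxl hxj, conj_rot_mul_apply_right hlj]
      have e : A l x * (-(Complex.exp (-(Complex.I * φ)) * Real.sin θ)) + A i x * (Real.cos θ : ℂ)
          - A i x = A i x * ((Real.cos θ - 1 : ℝ) : ℂ)
            + A l x * (-(Complex.exp (-(Complex.I * φ)) * Real.sin θ)) := by push_cast; ring
      rw [e]
      refine (norm_add_le _ _).trans ?_
      rw [norm_mul, norm_mul, norm_neg, norm_mul, hexp', hss, one_mul]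
      have h1 := mul_le_mul (hp i x (Ne.symm hxj)) hcc (norm_nonneg _) hp0
      have h2 := mul_le_mul_of_nonneg_right (hp l x (Ne.symm hxl)) (abs_nonneg (Real.sin θ))
      linarith
  by_cases hi : i = l ∨ i = j
  · have hx : ¬ (x = l ∨ x = j) := fun hx => hix ⟨hi, hx⟩
    rw [not_or] at hx
    exact key i x hi hx.1 hx.2
  by_cases hx : x = l ∨ x = j
  · rw [not_or] at hi
    have := key x i hx hi.1 hi.2
    rwa [← hA'.apply i x, ← hA.apply i x, ← star_sub, norm_star]
  · rw [not_or] at hi hx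
    obtain ⟨φ, -, rfl, -⟩ := h
    rw [conj_rot_apply_other _ _ _ hi.1 hi.2 hx.1 hx.2, sub_self, norm_zero]
    positivity

end IsApproxRotation

/-! ### Off-diagonal weight and its change under a rotation -/

/-- The places `(l, j)` and `(j, l)`. -/
def IsPivot (l j i x : Fin n) : Prop := (i = l ∧ x = j) ∨ (i = j ∧ x = l)

theorem maskedSq_nonneg (D : Fin n → Fin n → Prop) (A : Matrix (Fin n) (Fin n) ℂ) :
    0 ≤ maskedSq D A := by
  unfold maskedSq
  refine Finset.sum_nonneg fun i _ => Finset.sum_nonneg fun x _ => ?_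
  split_ifs <;> positivity

theorem maskedSq_mono {D D' : Fin n → Fin n → Prop} (h : ∀ i x, D i x → D' i x)
    (A : Matrix (Fin n) (Fin n) ℂ) : maskedSq D A ≤ maskedSq D' A := by
  unfold maskedSq
  refine Finset.sum_le_sum fun i _ => Finset.sum_le_sum fun x _ => ?_
  by_cases hD : D i x
  · rw [if_pos hD, if_pos (h i x hD)]
  · rw [if_neg hD]
    split_ifs <;> positivity

theorem maskedSq_congr {D D' : Fin n → Fin n → Prop} (h : ∀ i x, D i x ↔ D' i x)
    (A : Matrix (Fin n) (Fin n) ℂ) : maskedSq D A = maskedSq D' A :=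
  le_antisymm (maskedSq_mono (fun i x => (h i x).1) A) (maskedSq_mono (fun i x => (h i x).2) A)

theorem maskedSq_or {D D' : Fin n → Fin n → Prop} (h : ∀ i x, D i x → ¬ D' i x)
    (A : Matrix (Fin n) (Fin n) ℂ) :
    maskedSq (fun i x => D i x ∨ D' i x) A = maskedSq D A + maskedSq D' A := by
  unfold maskedSq
  simp only [← Finset.sum_add_distrib]
  refine Finset.sum_congr rfl fun i _ => Finset.sum_congr rfl fun x _ => ?_
  by_cases hD : D i x
  · simp [hD, h i x hD]
  · by_cases hD' : D' i x <;> simp [hD, hD']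

theorem maskedSq_isPivot {l j : Fin n} (hlj : l ≠ j) {A : Matrix (Fin n) (Fin n) ℂ}
    (hA : A.IsHermitian) : maskedSq (IsPivot l j) A = 2 * ‖A l j‖ ^ 2 := by
  have h : ∀ a b : Fin n, maskedSq (fun i x => i = a ∧ x = b) A = ‖A a b‖ ^ 2 := by
    intro a b
    unfold maskedSq
    rw [Finset.sum_eq_single a, Finset.sum_eq_single b]
    · simp
    · intro x _ hx; simp [hx]
    · simp
    · intro i _ hi; simp [hi]
    · simp
  unfold IsPivot
  rw [maskedSq_or (D := fun i x => i = l ∧ x = j) (D' := fun i x => i = j ∧ x = l), h, h,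
    ← hA.apply j l, norm_star]
  · ring
  · rintro i x ⟨rfl, rfl⟩ ⟨h1, -⟩
    exact hlj h1

theorem two_mul_offNorm_sq {A : Matrix (Fin n) (Fin n) ℂ} (hA : A.IsHermitian) :
    2 * offNorm A ^ 2 = maskedSq (fun i x => i ≠ x) A := by
  have h1 : offNorm A ^ 2 = maskedSq (fun i x => i < x) A := by
    unfold offNorm maskedSq
    rw [Real.sq_sqrt]
    · refine Finset.sum_congr rfl fun i _ => Finset.sum_congr rfl fun x _ => ?_
      congr 1
    · refine Finset.sum_nonneg fun i _ => Finset.sum_nonneg fun x _ => ?_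
      split_ifs <;> positivity
  have h2 : maskedSq (fun i x => x < i) A = maskedSq (fun i x => i < x) A := by
    unfold maskedSq
    rw [Finset.sum_comm]
    refine Finset.sum_congr rfl fun i _ => Finset.sum_congr rfl fun x _ => ?_
    rw [← hA.apply i x, norm_star]
  rw [maskedSq_congr (D' := fun i x => i < x ∨ x < i) (fun i x => ne_iff_lt_or_gt),
    maskedSq_or (fun i x h => h.not_gt), h2, h1]
  ring

theorem offNorm_nonneg (A : Matrix (Fin n) (Fin n) ℂ) : 0 ≤ offNorm A := Real.sqrt_nonneg _

theorem norm_apply_le_offNorm {A : Matrix (Fin n) (Fin n) ℂ} (hA : A.IsHermitian) {i x : Fin n}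
    (hix : i ≠ x) : ‖A i x‖ ≤ offNorm A := by
  refine abs_le_of_sq_le_sq' ?_ (offNorm_nonneg A) |>.2
  have h := maskedSq_isPivot hix hA
  have h2 := two_mul_offNorm_sq hA
  have h3 := maskedSq_mono (D := IsPivot i x) (D' := fun i x => i ≠ x) (by
    rintro a b (⟨rfl, rfl⟩ | ⟨rfl, rfl⟩)
    · exact hix
    · exact hix.symm) A
  linarith

/-- A rotation changes the off-diagonal weight only through the pivot entry. -/
theorem IsApproxRotation.offNorm_sq {η : ℝ} {l j : Fin n} {A A' : Matrix (Fin n) (Fin n) ℂ} {θ : ℝ}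
    (h : IsApproxRotation η l j A A' θ) (hlj : l ≠ j) (hA : A.IsHermitian) :
    offNorm A' ^ 2 = offNorm A ^ 2 - ‖A l j‖ ^ 2 + ‖A' l j‖ ^ 2 := by
  have key : ∀ B : Matrix (Fin n) (Fin n) ℂ, B.IsHermitian → 2 * offNorm B ^ 2
      = maskedSq (fun i x => i ≠ x ∧ ¬ IsPivot l j i x) B + 2 * ‖B l j‖ ^ 2 := by
    intro B hB
    rw [two_mul_offNorm_sq hB, ← maskedSq_isPivot hlj hB, ← maskedSq_or (fun i x h => h.2)]
    refine maskedSq_congr (fun i x => ?_) B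
    constructor
    · intro h; by_cases hp : IsPivot l j i x
      · exact Or.inr hp
      · exact Or.inl ⟨h, hp⟩
    · rintro (h | ⟨rfl, rfl⟩ | ⟨rfl, rfl⟩)
      · exact h.1
      · exact hlj
      · exact hlj.symm
  have h1 := key A hA
  have h2 := key A' (h.isHermitian hA)
  have h3 : maskedSq (fun i x => i ≠ x ∧ ¬ IsPivot l j i x) A'
      = maskedSq (fun i x => i ≠ x ∧ ¬ IsPivot l j i x) A := by
    obtain ⟨φ, -, rfl, -⟩ := h
    refine maskedSq_conj_rot hlj _ _ _ _ ?_ ?_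
    · intro i x; unfold IsPivot; tauto
    · intro i; unfold IsPivot
      by_cases h1 : i = l <;> by_cases h2 : i = j <;> simp_all
  linarith

/-! ### Diagonal and off-diagonal entries versus the spectrum -/

/-- `A` is unitarily diagonalized by `U` with the eigenvalues `ev`. -/
structure IsDiagonalizedBy (A : Matrix (Fin n) (Fin n) ℂ) (ev : Fin n → ℝ)
    (U : Matrix (Fin n) (Fin n) ℂ) : Prop where
  star_mul_self : Uᴴ * U = 1
  eq : A = Uᴴ * diagonal (fun i => (ev i : ℂ)) * U

theorem apply_eq_sum_of_eq (U : Matrix (Fin n) (Fin n) ℂ) (v : Fin n → ℂ) (i x : Fin n) :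
    (Uᴴ * diagonal v * U) i x = ∑ s, v s * (star (U s i) * U s x) := by
  rw [Matrix.mul_apply]
  refine Finset.sum_congr rfl fun s _ => ?_
  rw [mul_diagonal, conjTranspose_apply]
  ring

namespace IsDiagonalizedBy

variable {A U : Matrix (Fin n) (Fin n) ℂ} {ev : Fin n → ℝ}

theorem isHermitian (h : IsDiagonalizedBy A ev U) : A.IsHermitian := by
  rw [h.eq]
  refine isHermitian_conjTranspose_mul_mul _ ?_
  rw [isHermitian_diagonal_iff]
  intro i
  exact Complex.conj_ofReal _

theorem conj {R : Matrix (Fin n) (Fin n) ℂ} (h : IsDiagonalizedBy A ev U) (hR : Rᴴ * R = 1) :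
    IsDiagonalizedBy (Rᴴ * A * R) ev (U * R) where
  star_mul_self := by
    rw [conjTranspose_mul, Matrix.mul_assoc, ← Matrix.mul_assoc Uᴴ, h.star_mul_self,
      Matrix.one_mul, hR]
  eq := by
    rw [conjTranspose_mul]
    conv_lhs => rw [h.eq]
    simp only [Matrix.mul_assoc]

theorem sum_star_mul (h : IsDiagonalizedBy A ev U) (i x : Fin n) :
    ∑ s, star (U s i) * U s x = if i = x then 1 else 0 := by
  have := congrFun (congrFun h.star_mul_self i) x
  rw [Matrix.mul_apply] at this
  simpa [conjTranspose_apply, Matrix.one_apply] using this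

/-- Rows of `U` belong to eigenvalues, columns to positions, and the squares ‖U s i‖² form a doubly
stochastic matrix; each diagonal entry is an average of eigenvalues with these weights. -/
theorem sum_col (h : IsDiagonalizedBy A ev U) (i : Fin n) : ∑ s, ‖U s i‖ ^ 2 = 1 := by
  have := h.sum_star_mul i i
  rw [if_pos rfl] at this
  apply Complex.ofReal_injective
  rw [Complex.ofReal_one, ← this]
  push_cast
  refine Finset.sum_congr rfl fun s _ => ?_
  rw [Complex.star_def, mul_comm, Complex.mul_conj, Complex.normSq_eq_norm_sq]
  push_cast
  rfl

theorem sum_row (h : IsDiagonalizedBy A ev U) (s : Fin n) : ∑ i, ‖U s i‖ ^ 2 = 1 := by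
  have h1 : U * Uᴴ = 1 := mul_eq_one_comm.1 h.star_mul_self
  have := congrFun (congrFun h1 s) s
  rw [Matrix.mul_apply, Matrix.one_apply_eq] at this
  apply Complex.ofReal_injective
  rw [Complex.ofReal_one, ← this]
  push_cast
  refine Finset.sum_congr rfl fun i _ => ?_
  rw [conjTranspose_apply, Complex.star_def, Complex.mul_conj, Complex.normSq_eq_norm_sq]
  push_cast
  rfl

theorem apply_eq_sum (h : IsDiagonalizedBy A ev U) (i x : Fin n) :
    A i x = ∑ s, (ev s : ℂ) * (star (U s i) * U s x) := by
  conv_lhs => rw [h.eq]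
  exact apply_eq_sum_of_eq U _ i x

theorem re_diag_eq_sum (h : IsDiagonalizedBy A ev U) (i : Fin n) :
    (A i i).re = ∑ s, ev s * ‖U s i‖ ^ 2 := by
  rw [h.apply_eq_sum, Complex.re_sum]
  refine Finset.sum_congr rfl fun s _ => ?_
  rw [Complex.re_ofReal_mul, Complex.star_def, mul_comm _ (U s i), Complex.mul_conj,
    Complex.normSq_eq_norm_sq, Complex.ofReal_re]

theorem diag_mem_Icc (h : IsDiagonalizedBy A ev U) {g : ℝ} (hev : ∀ s, ev s ∈ Set.Icc 0 g)
    (i : Fin n) : (A i i).re ∈ Set.Icc 0 g := by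
  rw [h.re_diag_eq_sum]
  constructor
  · exact Finset.sum_nonneg fun s _ => mul_nonneg (hev s).1 (sq_nonneg _)
  · calc ∑ s, ev s * ‖U s i‖ ^ 2 ≤ ∑ s, g * ‖U s i‖ ^ 2 :=
        Finset.sum_le_sum fun s _ => mul_le_mul_of_nonneg_right (hev s).2 (sq_nonneg _)
      _ = g := by rw [← Finset.mul_sum, h.sum_col, mul_one]

theorem sum_diag (h : IsDiagonalizedBy A ev U) : ∑ i, (A i i).re = ∑ s, ev s := by
  simp only [h.re_diag_eq_sum]
  rw [Finset.sum_comm]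
  refine Finset.sum_congr rfl fun s _ => ?_
  rw [← Finset.mul_sum, h.sum_row, mul_one]

/-- Both sides are the squared norm of column `i` of A − μ, computed in the eigenbasis and in the
standard basis. -/
theorem sum_sq_sub_mul (h : IsDiagonalizedBy A ev U) (μ : ℝ) (i : Fin n) :
    ∑ s, (ev s - μ) ^ 2 * ‖U s i‖ ^ 2
      = ∑ x, ‖A x i - if x = i then (μ : ℂ) else 0‖ ^ 2 := by
  set v : Fin n → ℂ := fun s => ((ev s - μ : ℝ) : ℂ) with hv
  set B := Uᴴ * diagonal v * U with hB
  have hBx : ∀ x, B x i = A x i - if x = i then (μ : ℂ) else 0 := by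
    intro x
    rw [hB, apply_eq_sum_of_eq, h.apply_eq_sum]
    have h1 := h.sum_star_mul x i
    have h2 : (if x = i then (μ : ℂ) else 0) = μ * ∑ s, star (U s x) * U s i := by
      rw [h1]; split_ifs <;> simp
    rw [h2, Finset.mul_sum, ← Finset.sum_sub_distrib]
    refine Finset.sum_congr rfl fun s _ => ?_
    rw [hv]
    push_cast
    ring
  have hBB : Bᴴ * B = Uᴴ * diagonal (fun s => v s * v s) * U := by
    have h1 : U * Uᴴ = 1 := mul_eq_one_comm.1 h.star_mul_self
    have h2 : (diagonal v)ᴴ = diagonal v := by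
      rw [diagonal_conjTranspose]
      congr 1
      funext s
      exact Complex.conj_ofReal _
    have h3 : ∀ M : Matrix (Fin n) (Fin n) ℂ, U * (Uᴴ * M) = M := fun M => by
      rw [← Matrix.mul_assoc, h1, Matrix.one_mul]
    rw [hB, conjTranspose_mul, conjTranspose_mul, conjTranspose_conjTranspose, h2,
      ← diagonal_mul_diagonal]
    simp only [Matrix.mul_assoc, h3]
  have h4 := congrFun (congrFun hBB i) i
  rw [apply_eq_sum_of_eq, Matrix.mul_apply] at h4
  apply Complex.ofReal_injective
  rw [Complex.ofReal_sum, Complex.ofReal_sum]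
  convert h4.symm using 1
  · refine Finset.sum_congr rfl fun s _ => ?_
    rw [Complex.star_def, mul_comm ((starRingEnd ℂ) (U s i)), Complex.mul_conj,
      Complex.normSq_eq_norm_sq, hv]
    push_cast
    ring
  · refine Finset.sum_congr rfl fun x _ => ?_
    rw [conjTranspose_apply, ← hBx, Complex.star_def, mul_comm ((starRingEnd ℂ) (B x i)),
      Complex.mul_conj, Complex.normSq_eq_norm_sq]

/-- With μ the diagonal entry itself, column `i` of A − μ has only its off-diagonal part left. -/
theorem sum_sq_sub_diag_le (h : IsDiagonalizedBy A ev U) (i : Fin n) :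
    ∑ s, (ev s - (A i i).re) ^ 2 * ‖U s i‖ ^ 2 ≤ 2 * offNorm A ^ 2 := by
  have hA := h.isHermitian
  rw [h.sum_sq_sub_mul, two_mul_offNorm_sq hA]
  unfold maskedSq
  rw [Finset.sum_comm]
  refine le_trans (Finset.sum_le_sum fun x _ => ?_) (Finset.single_le_sum
    (f := fun y => ∑ x, @ite ℝ (x ≠ y) (Classical.propDecidable _) (‖A x y‖ ^ 2) 0)
    (fun y _ => Finset.sum_nonneg fun x _ => by split_ifs <;> positivity) (Finset.mem_univ i))
  by_cases hx : x = i
  · subst hx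
    have h0 : A x x - ((A x x).re : ℂ) = 0 := sub_eq_zero.2 (hA.coe_re_apply_self x).symm
    simp [h0]
  · simp [hx]

/-- Each diagonal entry is close to an eigenvalue. -/
theorem exists_abs_sub_le (h : IsDiagonalizedBy A ev U) (i : Fin n) :
    ∃ s, |ev s - (A i i).re| ≤ 2 * offNorm A := by
  by_contra! hcon
  have hp := offNorm_nonneg A
  have h1 := h.sum_sq_sub_diag_le i
  have h2 := h.sum_col i
  have h5 : ∃ s ∈ Finset.univ, 0 < ‖U s i‖ ^ 2 := by
    by_contra! hz
    have := Finset.sum_nonpos hz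
    linarith
  obtain ⟨s, -, hs⟩ := h5
  have h3 : ∑ s, (2 * offNorm A) ^ 2 * ‖U s i‖ ^ 2
      < ∑ s, (ev s - (A i i).re) ^ 2 * ‖U s i‖ ^ 2 := by
    have h4 : ∀ s, (2 * offNorm A) ^ 2 < (ev s - (A i i).re) ^ 2 := fun s => by
      rw [← sq_abs (ev s - _)]
      exact pow_lt_pow_left₀ (hcon s) (by positivity) (by norm_num)
    refine Finset.sum_lt_sum (fun s _ => mul_le_mul_of_nonneg_right (h4 s).le (sq_nonneg _))
      ⟨s, Finset.mem_univ s, mul_lt_mul_of_pos_right (h4 s) hs⟩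
  rw [← Finset.mul_sum, h2] at h3
  nlinarith [sq_nonneg (offNorm A)]

/-- Off-diagonal entries between positions that belong to the same eigenvalue are quadratically
small. -/
theorem norm_apply_le_of_same (h : IsDiagonalizedBy A ev U) {δ lam : ℝ} (hδ : 0 < δ)
    (hgap : ∀ s, ev s ≠ lam → 3 * δ ≤ |ev s - lam|) {i x : Fin n} (hix : i ≠ x)
    (hi : |(A i i).re - lam| ≤ δ) (hx : |(A x x).re - lam| ≤ δ) :
    ‖A i x‖ ≤ 2 * offNorm A ^ 2 / δ := by
  have hsum : ∀ y, |(A y y).re - lam| ≤ δ →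
      ∑ s, (ev s - lam) ^ 2 * ‖U s y‖ ^ 2 ≤ 9 / 2 * offNorm A ^ 2 := by
    intro y hy
    calc ∑ s, (ev s - lam) ^ 2 * ‖U s y‖ ^ 2
        ≤ ∑ s, 9 / 4 * ((ev s - (A y y).re) ^ 2 * ‖U s y‖ ^ 2) := by
          refine Finset.sum_le_sum fun s _ => ?_
          rw [← mul_assoc]
          refine mul_le_mul_of_nonneg_right ?_ (sq_nonneg _)
          by_cases hs : ev s = lam
          · rw [hs, sub_self, zero_pow two_ne_zero]; positivity
          · have h1 := hgap s hs
            have h2 : |ev s - lam| ≤ |ev s - (A y y).re| + |(A y y).re - lam| := abs_sub_le _ _ _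
            -- The diagonal entry is within δ of `lam`, that is, within a third of the distance from
            -- `lam` to any other eigenvalue.
            have h3 : |ev s - lam| ≤ 3 / 2 * |ev s - (A y y).re| := by linarith
            have h4 := pow_le_pow_left₀ (abs_nonneg _) h3 2
            rw [mul_pow, sq_abs, sq_abs] at h4
            linarith
      _ ≤ 9 / 2 * offNorm A ^ 2 := by
          rw [← Finset.mul_sum]
          linarith [h.sum_sq_sub_diag_le y]
  -- Orthogonality of the columns of `U` permits subtracting `lam`. The eigenvalue `lam` then drops
  -- out, and on the others |ev − lam| ≤ (ev − lam)²/(3δ) makes the sum quadratic in `offNorm A`.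
  have e : A i x = ∑ s, ((ev s - lam : ℝ) : ℂ) * (star (U s i) * U s x) := by
    rw [h.apply_eq_sum]
    have h1 := h.sum_star_mul i x
    rw [if_neg hix] at h1
    have h2 : ∑ s, (lam : ℂ) * (star (U s i) * U s x) = 0 := by rw [← Finset.mul_sum, h1, mul_zero]
    rw [← sub_zero (∑ s, (ev s : ℂ) * _), ← h2, ← Finset.sum_sub_distrib]
    refine Finset.sum_congr rfl fun s _ => ?_
    push_cast
    ring
  have hterm : ∀ s, ‖((ev s - lam : ℝ) : ℂ) * (star (U s i) * U s x)‖
      ≤ ((ev s - lam) ^ 2 * ‖U s i‖ ^ 2 + (ev s - lam) ^ 2 * ‖U s x‖ ^ 2) / (6 * δ) := by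
    intro s
    rw [norm_mul, norm_mul, norm_star, Complex.norm_real, Real.norm_eq_abs]
    by_cases hs : ev s = lam
    · rw [hs, sub_self]; simp
    · have h1 := hgap s hs
      rw [le_div_iff₀ (by positivity)]
      have h2 : |ev s - lam| * (3 * δ) ≤ (ev s - lam) ^ 2 := by
        rw [← sq_abs (ev s - lam), sq]
        exact mul_le_mul_of_nonneg_left h1 (abs_nonneg _)
      have h3 := two_mul_le_add_sq ‖U s i‖ ‖U s x‖
      have h4 : 0 ≤ ‖U s i‖ * ‖U s x‖ := by positivity
      nlinarith [mul_le_mul_of_nonneg_right h2 h4,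
        mul_le_mul_of_nonneg_left h3 (sq_nonneg (ev s - lam))]
  rw [e]
  refine (norm_sum_le _ _).trans ((Finset.sum_le_sum fun s _ => hterm s).trans ?_)
  rw [← Finset.sum_div, Finset.sum_add_distrib, div_le_div_iff₀ (by positivity) hδ]
  have h1 := hsum i hi
  have h2 := hsum x hx
  have h3 : 0 ≤ offNorm A ^ 2 := sq_nonneg _
  nlinarith

/-- Different positions belong to different eigenvalues if these are simple. -/
theorem eq_of_same_of_injective (h : IsDiagonalizedBy A ev U) {δ : ℝ} (hδ : 0 < δ)
    (hinj : Function.Injective ev) {s₀ : Fin n}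
    (hgap : ∀ s, ev s ≠ ev s₀ → 3 * δ ≤ |ev s - ev s₀|) (hp : offNorm A < δ) {i x : Fin n}
    (hi : |(A i i).re - ev s₀| ≤ δ) (hx : |(A x x).re - ev s₀| ≤ δ) : i = x := by
  by_contra hix
  -- Each such position claims more than half of row `s₀`, whose total weight is 1, so two of them
  -- cannot coexist.
  have hbig : ∀ y, |(A y y).re - ev s₀| ≤ δ → 1 / 2 < ‖U s₀ y‖ ^ 2 := by
    intro y hy
    have h1 := h.sum_sq_sub_diag_le y
    have h2 := h.sum_col y
    rw [← Finset.add_sum_erase _ _ (Finset.mem_univ s₀)] at h2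
    have h3 : ∑ s ∈ univ.erase s₀, 4 * δ ^ 2 * ‖U s y‖ ^ 2 ≤ 2 * offNorm A ^ 2 := by
      refine le_trans (Finset.sum_le_sum fun s hs => ?_)
        ((Finset.sum_le_sum_of_subset_of_nonneg (Finset.subset_univ _)
          fun _ _ _ => by positivity).trans h1)
      refine mul_le_mul_of_nonneg_right ?_ (sq_nonneg _)
      have h4 := hgap s (fun hss => (Finset.mem_erase.1 hs).1 (hinj hss))
      have h5 : |ev s - ev s₀| ≤ |ev s - (A y y).re| + |(A y y).re - ev s₀| := abs_sub_le _ _ _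
      have h6 : 2 * δ ≤ |ev s - (A y y).re| := by linarith
      have h7 := pow_le_pow_left₀ (by positivity) h6 2
      rw [sq_abs] at h7
      linarith
    rw [← Finset.mul_sum] at h3
    have h8 : offNorm A ^ 2 < δ ^ 2 := pow_lt_pow_left₀ hp (offNorm_nonneg A) (by norm_num)
    have h9 : 0 < δ ^ 2 := by positivity
    by_contra! hcon
    nlinarith
  have h1 := h.sum_row s₀
  have h2 := Finset.sum_le_sum_of_subset_of_nonneg (f := fun y => ‖U s₀ y‖ ^ 2)
    (Finset.subset_univ {i, x}) fun _ _ _ => by positivity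
  rw [Finset.sum_pair hix, h1] at h2
  linarith [hbig i hi, hbig x hx]

end IsDiagonalizedBy

theorem isDiagonalizedBy_eigenvectorUnitary {G : Matrix (Fin n) (Fin n) ℂ} (hG : G.IsHermitian) :
    IsDiagonalizedBy G hG.eigenvalues (hG.eigenvectorUnitary : Matrix (Fin n) (Fin n) ℂ)ᴴ where
  star_mul_self := by
    rw [conjTranspose_conjTranspose]
    exact (Unitary.mem_iff.1 hG.eigenvectorUnitary.2).2
  eq := by
    rw [conjTranspose_conjTranspose]
    exact hG.spectral_theorem

/-! ### Unitarity of the precoders and bounds for the eigenvalues -/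

theorem IsRun.star_mul_self {G : Matrix (Fin n) (Fin n) ℂ} {f : ℕ → ℝ → ℝ} {η : ℝ}
    {J : ℕ → Fin n × Fin n} (hJ : IsRowCyclic J) {W : ℕ → Matrix (Fin n) (Fin n) ℂ}
    (hW : IsRun G f η J W) (k : ℕ) : (W k)ᴴ * W k = 1 := by
  induction k with
  | zero => rw [hW.init]; simp
  | succ k ih =>
    obtain ⟨φ, t, -, -, hstep⟩ := hW.step (k + 1) (by omega)
    rw [hstep, Nat.add_sub_cancel, conjTranspose_mul, Matrix.mul_assoc, ← Matrix.mul_assoc (W k)ᴴ,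
      ih, Matrix.one_mul, conjTranspose_rot_mul_rot (hJ.pair_lt (k + 1) (by omega)).ne]

theorem IsRun.exists_isDiagonalizedBy {G : Matrix (Fin n) (Fin n) ℂ} (hG : G.IsHermitian)
    {f : ℕ → ℝ → ℝ} {η : ℝ} {J : ℕ → Fin n × Fin n} (hJ : IsRowCyclic J)
    {W : ℕ → Matrix (Fin n) (Fin n) ℂ} (hW : IsRun G f η J W) (k : ℕ) :
    ∃ U, IsDiagonalizedBy (iterate G W k) hG.eigenvalues U :=
  ⟨_, (isDiagonalizedBy_eigenvectorUnitary hG).conj (hW.star_mul_self hJ (k - 1))⟩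

theorem specNorm_nonneg (G : Matrix (Fin n) (Fin n) ℂ) : 0 ≤ specNorm G := norm_nonneg _

theorem eigenvalues_le_specNorm {G : Matrix (Fin n) (Fin n) ℂ} (hG : G.IsHermitian) (i : Fin n) :
    hG.eigenvalues i ≤ specNorm G := by
  have h1 := (Matrix.toEuclideanCLM (n := Fin n) (𝕜 := ℂ) G).le_opNorm (hG.eigenvectorBasis i)
  have h2 : Matrix.toEuclideanCLM (n := Fin n) (𝕜 := ℂ) G (hG.eigenvectorBasis i)
      = hG.eigenvalues i • hG.eigenvectorBasis i := by
    apply (WithLp.ofLp_injective 2)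
    rw [Matrix.ofLp_toEuclideanCLM, hG.mulVec_eigenvectorBasis]
    rfl
  rw [h2, norm_smul, OrthonormalBasis.norm_eq_one, mul_one, mul_one] at h1
  exact (le_abs_self _).trans h1

theorem sum_eigenvalues_le {G : Matrix (Fin n) (Fin n) ℂ} (hG : G.IsHermitian) :
    ∑ i, hG.eigenvalues i ≤ G.rank * specNorm G := by
  rw [hG.rank_eq_card_non_zero_eigs, Fintype.card_subtype]
  calc ∑ i, hG.eigenvalues i = ∑ i with hG.eigenvalues i ≠ 0, hG.eigenvalues i :=
        (Finset.sum_filter_ne_zero _).symm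
    _ ≤ ∑ i with hG.eigenvalues i ≠ 0, specNorm G :=
        Finset.sum_le_sum fun i _ => eigenvalues_le_specNorm hG i
    _ = _ := by rw [Finset.sum_const, nsmul_eq_mul]

/-! ### Combinatorics of the row-cyclic order -/

theorem card_filter_lt : #{p : Fin n × Fin n | p.1 < p.2} = sweepLength n := by
  have h1 : #{p : Fin n × Fin n | p.1 < p.2} = ∑ i : Fin n, #(Finset.Ioi i) := by
    rw [Finset.card_filter, Fintype.sum_prod_type]
    refine Finset.sum_congr rfl fun i _ => ?_
    rw [← Finset.card_filter]
    congr 1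
    ext x
    simp
  rw [h1, sweepLength, ← Finset.sum_range_id, ← Finset.sum_range_reflect, ← Fin.sum_univ_eq_sum_range
    (fun i => n - 1 - i)]
  refine Finset.sum_congr rfl fun i _ => ?_
  rw [Fin.card_Ioi]

namespace IsRowCyclic

variable {J : ℕ → Fin n × Fin n}

theorem injOn_Icc (hJ : IsRowCyclic J) : Set.InjOn J (Set.Icc 1 (sweepLength n)) := by
  have key : ∀ a b, 1 ≤ a → a < b → b ≤ sweepLength n → J a ≠ J b := by
    intro a b ha hab hb h
    rcases hJ.increasing a b ha hab hb with h1 | ⟨-, h1⟩ <;> rw [h] at h1 <;> exact lt_irrefl _ h1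
  intro a ha b hb h
  rcases lt_trichotomy a b with h1 | h1 | h1
  · exact absurd h (key a b ha.1 h1 hb.2)
  · exact h1
  · exact absurd h.symm (key b a hb.1 h1 ha.2)

theorem add_mul (hJ : IsRowCyclic J) {a : ℕ} (ha : 1 ≤ a) (t : ℕ) :
    J (a + sweepLength n * t) = J a := by
  induction t with
  | zero => simp
  | succ t ih => rw [Nat.mul_succ, ← add_assoc, hJ.periodic _ (by omega), ih]

theorem eq_mod (hJ : IsRowCyclic J) {q : ℕ} (hq : 1 ≤ q) :
    J q = J ((q - 1) % sweepLength n + 1) := by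
  rw [← hJ.add_mul (Nat.le_add_left 1 _) ((q - 1) / sweepLength n)]
  congr 1
  have := Nat.mod_add_div (q - 1) (sweepLength n)
  omega

/-- Two stages with the same pair are congruent modulo the period, and a window is too short to
contain two distinct such stages. -/
theorem injOn_window (hJ : IsRowCyclic J) {k : ℕ} (hk : 1 ≤ k) :
    Set.InjOn J (Finset.Ico k (k + sweepLength n)) := by
  intro a ha b hb h
  simp only [Finset.coe_Ico, Set.mem_Ico] at ha hb
  have hm : 0 < sweepLength n := by omega
  rw [hJ.eq_mod (by omega : 1 ≤ a), hJ.eq_mod (by omega : 1 ≤ b)] at h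
  have h1 := Nat.mod_lt (a - 1) hm
  have h2 := Nat.mod_lt (b - 1) hm
  have h3 := hJ.injOn_Icc ⟨by omega, by omega⟩ ⟨by omega, by omega⟩ h
  have h4 : (a - 1) ≡ (b - 1) [MOD sweepLength n] := by
    unfold Nat.ModEq; omega
  rcases le_total a b with hab | hab
  · have h5 := (Nat.modEq_iff_dvd' (by omega : a - 1 ≤ b - 1)).1 h4
    have := Nat.eq_zero_of_dvd_of_lt h5 (by omega)
    omega
  · have h5 := (Nat.modEq_iff_dvd' (by omega : b - 1 ≤ a - 1)).1 h4.symm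
    have := Nat.eq_zero_of_dvd_of_lt h5 (by omega)
    omega

/-- Any `sweepLength n` consecutive stages run through all pairs. -/
theorem image_window (hJ : IsRowCyclic J) {k : ℕ} (hk : 1 ≤ k) :
    (Finset.Ico k (k + sweepLength n)).image J
      = Finset.univ.filter fun p : Fin n × Fin n => p.1 < p.2 := by
  refine Finset.eq_of_subset_of_card_le ?_ ?_
  · intro p hp
    obtain ⟨q, hq, rfl⟩ := Finset.mem_image.1 hp
    rw [Finset.mem_Ico] at hq
    simpa using hJ.pair_lt q (by omega)
  · rw [card_filter_lt, Finset.card_image_of_injOn (hJ.injOn_window hk), Nat.card_Ico]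
    omega

theorem exists_mem_window (hJ : IsRowCyclic J) {k : ℕ} (hk : 1 ≤ k) {l j : Fin n} (hlj : l < j) :
    ∃ q, k ≤ q ∧ q < k + sweepLength n ∧ J q = (l, j) := by
  have h : (l, j) ∈ (Finset.Ico k (k + sweepLength n)).image J := by
    rw [hJ.image_window hk]; simpa using hlj
  obtain ⟨q, hq, h⟩ := Finset.mem_image.1 h
  rw [Finset.mem_Ico] at hq
  exact ⟨q, hq.1, hq.2, h⟩

theorem sum_window (hJ : IsRowCyclic J) {k : ℕ} (hk : 1 ≤ k) (F : Fin n × Fin n → ℝ) :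
    ∑ q ∈ Finset.Ico k (k + sweepLength n), F (J q)
      = ∑ p : Fin n × Fin n with p.1 < p.2, F p := by
  rw [← hJ.image_window hk, Finset.sum_image (hJ.injOn_window hk)]

theorem increasing_sweep (hJ : IsRowCyclic J) {k : ℕ} (hk : 1 ≤ k) (hdvd : sweepLength n ∣ k - 1)
    {a b : ℕ} (ha : k ≤ a) (hab : a < b) (hb : b < k + sweepLength n) :
    (J a).1 < (J b).1 ∨ ((J a).1 = (J b).1 ∧ (J a).2 < (J b).2) := by
  obtain ⟨t, ht⟩ := hdvd
  have h1 : J a = J (a - k + 1) := by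
    rw [← hJ.add_mul (a := a - k + 1) (by omega) t, ← ht]
    congr 1; omega
  have h2 : J b = J (b - k + 1) := by
    rw [← hJ.add_mul (a := b - k + 1) (by omega) t, ← ht]
    congr 1; omega
  rw [h1, h2]
  exact hJ.increasing _ _ (by omega) (by omega) (by omega)

end IsRowCyclic

/-- The place `(i, x)` has been the pivot (or its mirror image) in one of the stages
`k, …, q - 1`. -/
def IsProcessed (J : ℕ → Fin n × Fin n) (k q : ℕ) (i x : Fin n) : Prop :=
  ∃ a, k ≤ a ∧ a < q ∧ IsPivot (J a).1 (J a).2 i x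

theorem IsPivot.symm {l j i x : Fin n} (h : IsPivot l j i x) : IsPivot l j x i := by
  unfold IsPivot at *; tauto

theorem isProcessed_comm {J : ℕ → Fin n × Fin n} {k q : ℕ} {i x : Fin n} :
    IsProcessed J k q i x ↔ IsProcessed J k q x i :=
  ⟨fun ⟨a, h1, h2, h3⟩ => ⟨a, h1, h2, h3.symm⟩, fun ⟨a, h1, h2, h3⟩ => ⟨a, h1, h2, h3.symm⟩⟩

theorem isProcessed_succ {J : ℕ → Fin n × Fin n} {k q : ℕ} (hq : k ≤ q) {i x : Fin n} :
    IsProcessed J k (q + 1) i x ↔ IsProcessed J k q i x ∨ IsPivot (J q).1 (J q).2 i x := by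
  constructor
  · rintro ⟨a, h1, h2, h3⟩
    rcases (Nat.lt_succ_iff_lt_or_eq.1 h2) with h | rfl
    · exact Or.inl ⟨a, h1, h, h3⟩
    · exact Or.inr h3
  · rintro (⟨a, h1, h2, h3⟩ | h)
    · exact ⟨a, h1, by omega, h3⟩
    · exact ⟨q, hq, by omega, h⟩

namespace IsRowCyclic

variable {J : ℕ → Fin n × Fin n}

theorem isProcessed_sweep (hJ : IsRowCyclic J) {k : ℕ} (hk : 1 ≤ k) {i x : Fin n} (hix : i ≠ x) :
    IsProcessed J k (k + sweepLength n) i x := by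
  rcases lt_or_gt_of_ne hix with h | h
  · obtain ⟨q, h1, h2, h3⟩ := hJ.exists_mem_window hk h
    exact ⟨q, h1, h2, Or.inl (by simp [h3])⟩
  · obtain ⟨q, h1, h2, h3⟩ := hJ.exists_mem_window hk h
    exact ⟨q, h1, h2, Or.inr (by simp [h3])⟩

/-- In a sweep, exactly the pairs preceding the pivot in lexicographic order are processed. -/
theorem isProcessed_iff (hJ : IsRowCyclic J) {k q : ℕ} (hk : 1 ≤ k)
    (hdvd : sweepLength n ∣ k - 1) (hq : k ≤ q) (hq' : q < k + sweepLength n) {i x : Fin n}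
    (hix : i < x) :
    IsProcessed J k q i x ↔ i < (J q).1 ∨ (i = (J q).1 ∧ x < (J q).2) := by
  constructor
  · rintro ⟨a, h1, h2, ⟨rfl, rfl⟩ | ⟨rfl, rfl⟩⟩
    · exact hJ.increasing_sweep hk hdvd h1 h2 hq'
    · exact absurd hix (hJ.pair_lt a (by omega)).not_gt
  · intro h
    obtain ⟨a, h1, h2, h3⟩ := hJ.exists_mem_window hk hix
    rcases lt_trichotomy a q with h4 | rfl | h4
    · exact ⟨a, h1, h4, Or.inl (by simp [h3])⟩
    · rw [h3] at h
      rcases h with h | ⟨-, h⟩ <;> exact absurd h (lt_irrefl _)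
    · have h5 := hJ.increasing_sweep hk hdvd hq h4 h2
      rw [h3] at h5
      rcases h with h | ⟨h, h'⟩ <;> rcases h5 with h5 | ⟨h5, h5'⟩
      · exact absurd h h5.not_gt
      · exact absurd h5 h.ne'
      · exact absurd h h5.ne'
      · exact absurd h' h5'.not_gt

/-- If the classes of `c` are intervals, then a stage with a pivot inside a class mixes only
processed places with processed ones. -/
theorem isProcessed_iff_of_same (hJ : IsRowCyclic J) {k q : ℕ} (hk : 1 ≤ k)
    (hdvd : sweepLength n ∣ k - 1) (hq : k ≤ q) (hq' : q < k + sweepLength n) {c : Fin n → ℝ}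
    (hc : ∀ i j p, i ≤ j → j ≤ p → c i = c p → c j = c i) (hs : c (J q).1 = c (J q).2) {x : Fin n}
    (hx : c x ≠ c (J q).1) : IsProcessed J k q x (J q).1 ↔ IsProcessed J k q x (J q).2 := by
  have hlj := hJ.pair_lt q (by omega)
  -- Left of the pivot pair, both places are processed; right of it, neither is. Strictly between,
  -- `x` would belong to the class of the pivot, since classes are intervals.
  rcases lt_trichotomy x (J q).1 with h | h | h
  · rw [hJ.isProcessed_iff hk hdvd hq hq' h, hJ.isProcessed_iff hk hdvd hq hq' (h.trans hlj)]
    simp [h]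
  · exact absurd (by rw [h]) hx
  · rcases lt_trichotomy x (J q).2 with h' | h' | h'
    · exact absurd (hc _ _ _ h.le h'.le hs) hx
    · exact absurd (by rw [h', hs]) hx
    · rw [isProcessed_comm, isProcessed_comm (x := (J q).2), hJ.isProcessed_iff hk hdvd hq hq' h,
        hJ.isProcessed_iff hk hdvd hq hq' h']
      simp [h'.not_gt, hlj.not_gt, hlj.ne']

end IsRowCyclic

/-! ### Propagation of the processed weight through a sweep -/

/-- Minkowski's inequality: the constant κ on n² places has Euclidean norm nκ. -/
theorem maskedSq_le_of_norm_le {D : Fin n → Fin n → Prop} {A A' : Matrix (Fin n) (Fin n) ℂ} {κ : ℝ}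
    (hκ : 0 ≤ κ) (h : ∀ i x, D i x → ‖A' i x‖ ≤ ‖A i x‖ + κ) :
    maskedSq D A' ≤ (Real.sqrt (maskedSq D A) + n * κ) ^ 2 := by
  classical
  have e : ∀ B : Matrix (Fin n) (Fin n) ℂ,
      maskedSq D B = ∑ p : Fin n × Fin n, (if D p.1 p.2 then ‖B p.1 p.2‖ else 0) ^ 2 := by
    intro B
    rw [Fintype.sum_prod_type]
    unfold maskedSq
    refine Finset.sum_congr rfl fun i _ => Finset.sum_congr rfl fun x _ => ?_
    by_cases hD : D i x <;> simp [hD]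
  have h1 : maskedSq D A' ≤ ∑ p : Fin n × Fin n,
      ((if D p.1 p.2 then ‖A p.1 p.2‖ else 0) ^ 2
        + 2 * ((if D p.1 p.2 then ‖A p.1 p.2‖ else 0) * κ) + κ ^ 2) := by
    rw [e]
    refine Finset.sum_le_sum fun p _ => ?_
    by_cases hD : D p.1 p.2
    · simp only [if_pos hD]
      have := pow_le_pow_left₀ (norm_nonneg _) (h _ _ hD) 2
      linarith
    · simp only [if_neg hD]
      nlinarith [sq_nonneg κ]
  have h2 := Real.sum_mul_le_sqrt_mul_sqrt Finset.univ
    (fun p : Fin n × Fin n => if D p.1 p.2 then ‖A p.1 p.2‖ else 0) (fun _ => κ)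
  have h3 : Real.sqrt (∑ _p : Fin n × Fin n, κ ^ 2) = n * κ := by
    rw [Finset.sum_const, Finset.card_univ, Fintype.card_prod, Fintype.card_fin, nsmul_eq_mul]
    rw [show ((n * n : ℕ) : ℝ) * κ ^ 2 = (n * κ) ^ 2 by push_cast; ring]
    exact Real.sqrt_sq (by positivity)
  have h3' : ∑ _p : Fin n × Fin n, κ ^ 2 = (n * κ) ^ 2 := by
    rw [Finset.sum_const, Finset.card_univ, Fintype.card_prod, Fintype.card_fin, nsmul_eq_mul]
    push_cast; ring
  rw [h3, ← e] at h2
  rw [Finset.sum_add_distrib, Finset.sum_add_distrib, ← Finset.mul_sum, ← e, h3'] at h1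
  have h4 := Real.sq_sqrt (maskedSq_nonneg D A)
  nlinarith

/-- The induction step for errors of two kinds: perturbations κ add up linearly, while residuals r
add up in squares under the root. This keeps the constant of the residuals independent of the length
of the sweep. -/
theorem add_add_sqrt_le {K κ s r : ℝ} (hK : 0 ≤ K) (hκ : 0 ≤ κ) (hs : 0 ≤ s) (hr : 0 ≤ r)
    {E : ℝ} (hE : E ≤ K + Real.sqrt s) (hE0 : 0 ≤ E) :
    Real.sqrt ((E + κ) ^ 2 + r) ≤ K + κ + Real.sqrt (s + r) := by
  have h1 : Real.sqrt s ≤ Real.sqrt (s + r) := Real.sqrt_le_sqrt (by linarith)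
  have h2 := Real.sq_sqrt hs
  have h3 := Real.sq_sqrt (add_nonneg hs hr)
  have h4 := Real.sqrt_nonneg s
  rw [Real.sqrt_le_left (by positivity)]
  have h5 : (E + κ) ^ 2 ≤ (K + κ + Real.sqrt s) ^ 2 := by
    apply pow_le_pow_left₀ (by positivity); linarith
  nlinarith [mul_le_mul_of_nonneg_left h1 (add_nonneg hK hκ)]

/-- The weight of the processed places between different classes stays, up to small terms, the sum
of the residuals. -/
theorem sqrt_maskedSq_processed_le {J : ℕ → Fin n × Fin n} (hJ : IsRowCyclic J) {k m : ℕ}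
    (hk : 1 ≤ k) {A : ℕ → Matrix (Fin n) (Fin n) ℂ} (hA : ∀ q, (A q).IsHermitian) {η : ℝ}
    {θ : ℕ → ℝ}
    (hstep : ∀ q, k ≤ q → IsApproxRotation η (J q).1 (J q).2 (A q) (A (q + 1)) (θ q))
    {c : Fin n → ℝ} (hc : ∀ q, k ≤ q → q < k + m → c (J q).1 = c (J q).2 →
      ∀ x, c x ≠ c (J q).1 → (IsProcessed J k q x (J q).1 ↔ IsProcessed J k q x (J q).2))
    {p κ : ℝ} (hκ : 0 ≤ κ) (hp : ∀ q, k ≤ q → q < k + m → offNorm (A q) ≤ p)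
    (hsin : ∀ q, k ≤ q → q < k + m → c (J q).1 ≠ c (J q).2 → 2 * |Real.sin (θ q)| * p ≤ κ)
    (s : ℕ) (hs : s ≤ m) :
    Real.sqrt (maskedSq (fun i x => c i ≠ c x ∧ IsProcessed J k (k + s) i x) (A (k + s)))
      ≤ s * (n * κ) + Real.sqrt (2 * ∑ q ∈ Finset.Ico k (k + s),
          ‖A (q + 1) (J q).1 (J q).2‖ ^ 2) := by
  induction s with
  | zero =>
    have h0 : maskedSq (fun i x => c i ≠ c x ∧ IsProcessed J k (k + 0) i x) (A (k + 0)) = 0 := by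
      unfold maskedSq
      refine Finset.sum_eq_zero fun i _ => Finset.sum_eq_zero fun x _ => if_neg ?_
      rintro ⟨-, a, h1, h2, -⟩
      omega
    rw [h0]; simp
  | succ s ih =>
    have ih := ih (by omega)
    set q := k + s with hq
    have hkq : k ≤ q := by omega
    have hqm : q < k + m := by omega
    have hst := hstep q hkq
    have hlj : (J q).1 ≠ (J q).2 := (hJ.pair_lt q (by omega)).ne
    have hsum : ∑ a ∈ Finset.Ico k (k + (s + 1)), ‖A (a + 1) (J a).1 (J a).2‖ ^ 2
        = ∑ a ∈ Finset.Ico k q, ‖A (a + 1) (J a).1 (J a).2‖ ^ 2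
          + ‖A (q + 1) (J q).1 (J q).2‖ ^ 2 := by
      rw [← add_assoc, ← hq, Finset.sum_Ico_succ_top hkq]
    rw [hsum, ← add_assoc, ← hq]
    set D : Fin n → Fin n → Prop := fun i x => c i ≠ c x ∧ IsProcessed J k q i x with hD
    set S := ∑ a ∈ Finset.Ico k q, ‖A (a + 1) (J a).1 (J a).2‖ ^ 2 with hS
    have hS0 : 0 ≤ S := Finset.sum_nonneg fun _ _ => by positivity
    -- A pivot inside a class preserves the weight of the mask exactly, however large its angle. A
    -- pivot between classes perturbs the old places by κ and adds its own residual, at two mirror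
    -- places.
    by_cases hcl : c (J q).1 = c (J q).2
    · have h1 : maskedSq (fun i x => c i ≠ c x ∧ IsProcessed J k (q + 1) i x) (A (q + 1))
          = maskedSq D (A q) := by
        have h2 : maskedSq (fun i x => c i ≠ c x ∧ IsProcessed J k (q + 1) i x) (A (q + 1))
            = maskedSq D (A (q + 1)) := by
          refine maskedSq_congr (fun i x => ?_) _
          rw [isProcessed_succ hkq, hD]
          constructor
          · rintro ⟨h3, h4 | ⟨rfl, rfl⟩ | ⟨rfl, rfl⟩⟩
            · exact ⟨h3, h4⟩
            · exact absurd hcl h3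
            · exact absurd hcl.symm h3
          · rintro ⟨h3, h4⟩
            exact ⟨h3, Or.inl h4⟩
        rw [h2]
        obtain ⟨φ, -, h3, -⟩ := hst
        rw [h3]
        refine maskedSq_conj_rot hlj _ _ _ _ ?_ ?_
        · intro i x
          rw [hD]
          simp only
          rw [isProcessed_comm, ne_comm]
        · intro x
          rw [hD]
          simp only
          rw [← hcl]
          by_cases hx : c x = c (J q).1
          · simp [hx]
          · rw [hc q hkq hqm hcl x hx]
      rw [h1]
      refine ih.trans (add_le_add ?_ (Real.sqrt_le_sqrt ?_))
      · push_cast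
        nlinarith [mul_nonneg (Nat.cast_nonneg (α := ℝ) n) hκ]
      · have := sq_nonneg ‖A (q + 1) (J q).1 (J q).2‖
        linarith
    · have h1 : maskedSq (fun i x => c i ≠ c x ∧ IsProcessed J k (q + 1) i x) (A (q + 1))
          ≤ (Real.sqrt (maskedSq D (A q)) + n * κ) ^ 2
            + 2 * ‖A (q + 1) (J q).1 (J q).2‖ ^ 2 := by
        calc maskedSq (fun i x => c i ≠ c x ∧ IsProcessed J k (q + 1) i x) (A (q + 1))
            ≤ maskedSq (fun i x => (D i x ∧ ¬ IsPivot (J q).1 (J q).2 i x)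
                ∨ IsPivot (J q).1 (J q).2 i x) (A (q + 1)) := by
              refine maskedSq_mono (fun i x => ?_) _
              rw [isProcessed_succ hkq, hD]
              by_cases hpiv : IsPivot (J q).1 (J q).2 i x <;> simp [hpiv]
          _ = maskedSq (fun i x => D i x ∧ ¬ IsPivot (J q).1 (J q).2 i x) (A (q + 1))
              + 2 * ‖A (q + 1) (J q).1 (J q).2‖ ^ 2 := by
              rw [maskedSq_or (fun i x h => h.2), maskedSq_isPivot hlj (hA _)]
          _ ≤ _ := by
              refine add_le_add_left ?_ _
              refine (maskedSq_le_of_norm_le (A := A q) hκ ?_).trans ?_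
              · rintro i x ⟨⟨h3, -⟩, h4⟩
                have h5 : ¬ ((i = (J q).1 ∨ i = (J q).2) ∧ (x = (J q).1 ∨ x = (J q).2)) := by
                  rintro ⟨h6 | h6, h7 | h7⟩
                  · exact h3 (by rw [h6, h7])
                  · exact h4 (Or.inl ⟨h6, h7⟩)
                  · exact h4 (Or.inr ⟨h6, h7⟩)
                  · exact h3 (by rw [h6, h7])
                have h6 := hst.norm_apply_sub_le hlj (hA q)
                  (fun i x hix => (norm_apply_le_offNorm (hA q) hix).trans (hp q hkq hqm)) h5
                have h7 := norm_sub_norm_le (A (q + 1) i x) (A q i x)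
                linarith [hsin q hkq hqm hcl]
              · refine pow_le_pow_left₀ (by positivity) ?_ 2
                refine add_le_add_left (Real.sqrt_le_sqrt (maskedSq_mono (fun i x h => h.1) _)) _
      refine (Real.sqrt_le_sqrt h1).trans ?_
      refine (add_add_sqrt_le (by positivity) (by positivity) (by positivity) (by positivity) ih
        (Real.sqrt_nonneg _)).trans (le_of_eq ?_)
      push_cast
      rw [mul_add]
      ring

theorem IsDiagonalizedBy.norm_apply_le {A U : Matrix (Fin n) (Fin n) ℂ} {ev : Fin n → ℝ}
    (h : IsDiagonalizedBy A ev U) {g : ℝ} (hg : 0 ≤ g) (hev : ∀ s, ev s ∈ Set.Icc 0 g)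
    (i x : Fin n) : ‖A i x‖ ≤ g := by
  have h1 := h.sum_sq_sub_mul 0 x
  simp only [sub_zero, Complex.ofReal_zero, ite_self] at h1
  have h2 : ‖A i x‖ ^ 2 ≤ ∑ y, ‖A y x‖ ^ 2 :=
    Finset.single_le_sum (f := fun y => ‖A y x‖ ^ 2) (fun _ _ => sq_nonneg _) (Finset.mem_univ i)
  have h3 : ∑ s, ev s ^ 2 * ‖U s x‖ ^ 2 ≤ g ^ 2 := by
    calc ∑ s, ev s ^ 2 * ‖U s x‖ ^ 2 ≤ ∑ s, g ^ 2 * ‖U s x‖ ^ 2 :=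
        Finset.sum_le_sum fun s _ => mul_le_mul_of_nonneg_right
          (pow_le_pow_left₀ (hev s).1 (hev s).2 2) (sq_nonneg _)
      _ = g ^ 2 := by rw [← Finset.mul_sum, h.sum_col, mul_one]
  exact (abs_le_of_sq_le_sq' (by linarith) hg).2

/-! ### The residuals of one sweep -/

/-- The sum of the squared differences of the diagonal entries of a positive semidefinite matrix of
rank at most `r`. -/
theorem sum_sq_sub_le {a : Fin n → ℝ} {g : ℝ} (ha : ∀ i, a i ∈ Set.Icc 0 g) (hg : 0 ≤ g) {r : ℕ}
    (hr : 0 < r) (hrn : r < n) (hsum : ∑ i, a i ≤ r * g) :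
    ∑ p : Fin n × Fin n with p.1 < p.2, (a p.2 - a p.1) ^ 2
      ≤ (2 * n * r - r ^ 2 - r) / 2 * g ^ 2 := by
  have h1 : 2 * ∑ p : Fin n × Fin n with p.1 < p.2, (a p.2 - a p.1) ^ 2
      = ∑ i, ∑ j, (a j - a i) ^ 2 := by
    have e1 : ∑ p : Fin n × Fin n with p.1 < p.2, (a p.2 - a p.1) ^ 2
        = ∑ i, ∑ j, if i < j then (a j - a i) ^ 2 else 0 := by
      rw [Finset.sum_filter, Fintype.sum_prod_type]
    have e2 : ∑ p : Fin n × Fin n with p.1 < p.2, (a p.2 - a p.1) ^ 2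
        = ∑ i, ∑ j, if j < i then (a j - a i) ^ 2 else 0 := by
      rw [e1, Finset.sum_comm]
      refine Finset.sum_congr rfl fun i _ => Finset.sum_congr rfl fun j _ => ?_
      split_ifs
      · ring
      · rfl
    rw [two_mul]
    refine (congrArg₂ (· + ·) e1 e2).trans ?_
    rw [← Finset.sum_add_distrib]
    refine Finset.sum_congr rfl fun i _ => ?_
    rw [← Finset.sum_add_distrib]
    refine Finset.sum_congr rfl fun j _ => ?_
    rcases lt_trichotomy i j with h | rfl | h
    · simp [h, h.not_gt]
    · simp
    · simp [h, h.not_gt]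
  have h2 : ∑ i, ∑ j, (a j - a i) ^ 2 = 2 * (n * ∑ i, a i ^ 2 - (∑ i, a i) ^ 2) := by
    have e : ∀ i j, (a j - a i) ^ 2 = a j ^ 2 - 2 * (a i * a j) + a i ^ 2 := fun i j => by ring
    simp only [e, Finset.sum_add_distrib, Finset.sum_sub_distrib, Finset.sum_const,
      Finset.card_univ, Fintype.card_fin, nsmul_eq_mul, ← Finset.mul_sum, ← Finset.sum_mul]
    ring
  have h3 : ∑ i, a i ^ 2 ≤ g * ∑ i, a i := by
    rw [Finset.mul_sum]
    refine Finset.sum_le_sum fun i _ => ?_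
    rw [sq]
    exact mul_le_mul_of_nonneg_right (ha i).2 (ha i).1
  set T := ∑ i, a i
  have hT : 0 ≤ T := Finset.sum_nonneg fun i _ => (ha i).1
  have hr1 : (1 : ℝ) ≤ r := by exact_mod_cast hr
  have hn1 : (r : ℝ) + 1 ≤ n := by exact_mod_cast hrn
  have h4 : (n : ℝ) * ∑ i, a i ^ 2 ≤ n * (g * T) := by gcongr
  have h5 : 0 ≤ ((n : ℝ) - r - 1) * (g * (r * g - T)) :=
    mul_nonneg (by linarith) (mul_nonneg hg (by linarith))
  have h6 : 0 ≤ g ^ 2 * (((r : ℝ) - 1) * (r + 1)) :=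
    mul_nonneg (sq_nonneg _) (mul_nonneg (by linarith) (by linarith))
  -- With t = r g − T ≥ 0, the claimed bound exceeds n g T − T² by (n − r − 1) g t + (t − (r − 1)
  -- g/2)² + (r² − 1) g²/4.
  nlinarith [sq_nonneg ((r * g - T) - ((r : ℝ) - 1) * g / 2)]

/-- A sequence of unitarily similar matrices that is produced from stage `k` on by approximately
annihilating rotations with the pivots `J k, J (k + 1), …`. -/
structure IsRotationSequence (η g : ℝ) (J : ℕ → Fin n × Fin n) (ev : Fin n → ℝ) (k : ℕ)
    (A : ℕ → Matrix (Fin n) (Fin n) ℂ) (θ : ℕ → ℝ) : Prop where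
  eta_nonneg : 0 ≤ η
  eta_le_one : η ≤ 1
  bound_nonneg : 0 ≤ g
  one_le : 1 ≤ k
  isRowCyclic : IsRowCyclic J
  mem_Icc : ∀ s, ev s ∈ Set.Icc 0 g
  diagonalized : ∀ q, ∃ U, IsDiagonalizedBy (A q) ev U
  step : ∀ q, k ≤ q → IsApproxRotation η (J q).1 (J q).2 (A q) (A (q + 1)) (θ q)

namespace IsRotationSequence

variable {η g : ℝ} {J : ℕ → Fin n × Fin n} {ev : Fin n → ℝ} {k : ℕ}
  {A : ℕ → Matrix (Fin n) (Fin n) ℂ} {θ : ℕ → ℝ}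

theorem isHermitian (h : IsRotationSequence η g J ev k A θ) (q : ℕ) : (A q).IsHermitian := by
  obtain ⟨U, hU⟩ := h.diagonalized q
  exact hU.isHermitian

theorem ne (h : IsRotationSequence η g J ev k A θ) {q : ℕ} (hq : k ≤ q) : (J q).1 ≠ (J q).2 :=
  (h.isRowCyclic.pair_lt q (h.one_le.trans hq)).ne

theorem diag_mem (h : IsRotationSequence η g J ev k A θ) (q : ℕ) (i : Fin n) :
    (A q i i).re ∈ Set.Icc 0 g := by
  obtain ⟨U, hU⟩ := h.diagonalized q
  exact hU.diag_mem_Icc h.mem_Icc i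

theorem abs_sub_le (h : IsRotationSequence η g J ev k A θ) (q : ℕ) (i x : Fin n) :
    |(A q i i).re - (A q x x).re| ≤ g := by
  have h1 := h.diag_mem q i
  have h2 := h.diag_mem q x
  rw [abs_le]
  constructor <;> linarith [h1.1, h1.2, h2.1, h2.2]

theorem norm_apply_le (h : IsRotationSequence η g J ev k A θ) (q : ℕ) (i x : Fin n) :
    ‖A q i x‖ ≤ g := by
  obtain ⟨U, hU⟩ := h.diagonalized q
  exact hU.norm_apply_le h.bound_nonneg h.mem_Icc i x

theorem pivot_sq_le (h : IsRotationSequence η g J ev k A θ) {q : ℕ} (hq : k ≤ q) :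
    ‖A (q + 1) (J q).1 (J q).2‖ ^ 2 ≤ 6 * (η * g) ^ 2 := by
  have h1 := (h.step q hq).pivot_sq_le (h.ne hq) (h.isHermitian q)
  have h2 := pow_le_pow_left₀ (abs_nonneg _) (h.abs_sub_le q (J q).2 (J q).1) 2
  have h3 := pow_le_pow_left₀ (norm_nonneg _) (h.norm_apply_le q (J q).1 (J q).2) 2
  rw [sq_abs] at h2
  calc _ ≤ _ := h1
    _ ≤ η ^ 2 * (g ^ 2 + 5 * g ^ 2) := by gcongr
    _ = _ := by ring

/-- The squares of the annihilated pivots are discarded; only the residuals can increase the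
off-diagonal weight. -/
theorem offNorm_sq_le (h : IsRotationSequence η g J ev k A θ) (s : ℕ) :
    offNorm (A (k + s)) ^ 2 ≤ offNorm (A k) ^ 2
      + ∑ q ∈ Finset.Ico k (k + s), ‖A (q + 1) (J q).1 (J q).2‖ ^ 2 := by
  induction s with
  | zero => simp
  | succ s ih =>
    have h1 := (h.step (k + s) (by omega)).offNorm_sq (h.ne (by omega)) (h.isHermitian _)
    rw [← add_assoc, Finset.sum_Ico_succ_top (by omega), h1]
    have := sq_nonneg ‖A (k + s) (J (k + s)).1 (J (k + s)).2‖
    linarith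

theorem offNorm_sq_le_add_mul (h : IsRotationSequence η g J ev k A θ) (s : ℕ) :
    offNorm (A (k + s)) ^ 2 ≤ offNorm (A k) ^ 2 + 6 * s * (η * g) ^ 2 := by
  refine (h.offNorm_sq_le s).trans (add_le_add_right ?_ _)
  calc ∑ q ∈ Finset.Ico k (k + s), ‖A (q + 1) (J q).1 (J q).2‖ ^ 2
      ≤ ∑ q ∈ Finset.Ico k (k + s), 6 * (η * g) ^ 2 :=
        Finset.sum_le_sum fun q hq => h.pivot_sq_le (Finset.mem_Ico.1 hq).1
    _ = _ := by
        rw [Finset.sum_const, Nat.card_Ico, nsmul_eq_mul, Nat.add_sub_cancel_left]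
        ring

theorem offNorm_le (h : IsRotationSequence η g J ev k A θ) {m s : ℕ} (hm : 1 ≤ m) (hs : s ≤ m) :
    offNorm (A (k + s)) ≤ offNorm (A k) + 3 * m * (η * g) := by
  have h1 := h.offNorm_sq_le_add_mul s
  have h2 : 0 ≤ η * g := mul_nonneg h.eta_nonneg h.bound_nonneg
  have h3 := offNorm_nonneg (A k)
  have hm1 : (1 : ℝ) ≤ m := by exact_mod_cast hm
  have hsm : (s : ℝ) ≤ m := by exact_mod_cast hs
  refine (abs_le_of_sq_le_sq' (h1.trans ?_) (by positivity)).2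
  have h4 : (s : ℝ) * (η * g) ^ 2 ≤ m ^ 2 * (η * g) ^ 2 := by
    refine mul_le_mul_of_nonneg_right ?_ (sq_nonneg _)
    nlinarith
  have h5 : 0 ≤ offNorm (A k) * (m * (η * g)) := by positivity
  have h6 : 0 ≤ (m : ℝ) ^ 2 * (η * g) ^ 2 := by positivity
  nlinarith

/-- Every stage moves a diagonal entry by at most the current pivot plus 3ηg. The drift is small
enough to keep the affiliation with eigenvalues throughout a sweep. -/
theorem drift_le (h : IsRotationSequence η g J ev k A θ) {m s : ℕ} (hm : 1 ≤ m) (hs : s ≤ m)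
    (i : Fin n) :
    |(A (k + s) i i).re - (A k i i).re| ≤ m * offNorm (A k) + 6 * m ^ 2 * (η * g) := by
  have h2 : 0 ≤ η * g := mul_nonneg h.eta_nonneg h.bound_nonneg
  have hm1 : (1 : ℝ) ≤ m := by exact_mod_cast hm
  have h3 := offNorm_nonneg (A k)
  have key : ∀ s : ℕ, s ≤ m → |(A (k + s) i i).re - (A k i i).re|
      ≤ s * (offNorm (A k) + 3 * m * (η * g) + 3 * (η * g)) := by
    intro s
    induction s with
    | zero => simp
    | succ s ih =>
      intro hs
      have h4 := ih (by omega)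
      have hq : k ≤ k + s := by omega
      have h5 := (h.step (k + s) hq).abs_diag_sub_le (h.ne hq) h.eta_nonneg (h.isHermitian _) i
      have h6 := (norm_apply_le_offNorm (h.isHermitian (k + s)) (h.ne hq)).trans
        (h.offNorm_le hm (by omega : s ≤ m))
      have h7 : η * (|(A (k + s) (J (k + s)).2 (J (k + s)).2).re
          - (A (k + s) (J (k + s)).1 (J (k + s)).1).re|
            + 2 * ‖A (k + s) (J (k + s)).1 (J (k + s)).2‖) ≤ η * (g + 2 * g) :=
        mul_le_mul_of_nonneg_left (by
          linarith [h.abs_sub_le (k + s) (J (k + s)).2 (J (k + s)).1,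
            h.norm_apply_le (k + s) (J (k + s)).1 (J (k + s)).2]) h.eta_nonneg
      have h8 := _root_.abs_sub_le (A (k + (s + 1)) i i).re (A (k + s) i i).re (A k i i).re
      rw [← add_assoc] at h8 ⊢
      push_cast
      linarith
  refine (key s hs).trans ?_
  have hsm : (s : ℝ) ≤ m := by exact_mod_cast hs
  calc (s : ℝ) * (offNorm (A k) + 3 * m * (η * g) + 3 * (η * g))
      ≤ m * (offNorm (A k) + 3 * m * (η * g) + 3 * (η * g)) := by gcongr
    _ ≤ _ := by
      have h4 : (m : ℝ) * (η * g) ≤ m ^ 2 * (η * g) :=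
        mul_le_mul_of_nonneg_right (le_self_pow₀ hm1 two_ne_zero) h2
      linarith

/-- The residuals of one sweep. -/
theorem sum_pivot_sq_le (h : IsRotationSequence η g J ev k A θ) {r : ℕ} (hr : 0 < r) (hrn : r < n)
    (hev : ∑ s, ev s ≤ r * g) (hm : 1 ≤ sweepLength n) :
    ∑ q ∈ Finset.Ico k (k + sweepLength n), ‖A (q + 1) (J q).1 (J q).2‖ ^ 2
      ≤ (2 * n * r - r ^ 2 - r) * (η * g) ^ 2
        + 700 * sweepLength n ^ 5 * η ^ 2 * (offNorm (A k) ^ 2 + (η * g) ^ 2) := by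
  set m := sweepLength n with hmdef
  set p := offNorm (A k) with hp
  set e := η * g with he
  have hm1 : (1 : ℝ) ≤ m := by exact_mod_cast hm
  have he0 : 0 ≤ e := mul_nonneg h.eta_nonneg h.bound_nonneg
  have hp0 : 0 ≤ p := offNorm_nonneg _
  set d := m * p + 6 * m ^ 2 * e with hd
  have hd0 : 0 ≤ d := by positivity
  -- Replacing the current diagonal by that of stage `k` costs a factor 2 and the drift `d`, but
  -- then all differences come from one matrix and sum to a bound over all pairs.
  have hterm : ∀ q ∈ Finset.Ico k (k + m), ‖A (q + 1) (J q).1 (J q).2‖ ^ 2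
      ≤ η ^ 2 * (2 * ((A k (J q).2 (J q).2).re - (A k (J q).1 (J q).1).re) ^ 2
        + (8 * d ^ 2 + 5 * (p ^ 2 + 6 * m * e ^ 2))) := by
    intro q hq
    rw [Finset.mem_Ico] at hq
    obtain ⟨s, rfl⟩ := Nat.exists_eq_add_of_le hq.1
    have hs : s ≤ m := by omega
    have hsm : (s : ℝ) ≤ m := by exact_mod_cast hs
    refine ((h.step _ hq.1).pivot_sq_le (h.ne hq.1) (h.isHermitian _)).trans ?_
    refine mul_le_mul_of_nonneg_left ?_ (sq_nonneg _)
    have h1 := pow_le_pow_left₀ (norm_nonneg _)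
      (norm_apply_le_offNorm (h.isHermitian (k + s)) (h.ne hq.1)) 2
    have h2 := h.offNorm_sq_le_add_mul s
    have h3 := h.drift_le hm hs (J (k + s)).2
    have h4 := h.drift_le hm hs (J (k + s)).1
    rw [← hp, ← he] at h2
    rw [← hd] at h3 h4
    have h5 : 6 * s * e ^ 2 ≤ 6 * m * e ^ 2 := by gcongr
    set x2 := (A (k + s) (J (k + s)).2 (J (k + s)).2).re
    set x1 := (A (k + s) (J (k + s)).1 (J (k + s)).1).re
    set y2 := (A k (J (k + s)).2 (J (k + s)).2).re
    set y1 := (A k (J (k + s)).1 (J (k + s)).1).re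
    have h6 : |(x2 - y2) - (x1 - y1)| ≤ 2 * d := (abs_sub _ _).trans (by linarith)
    have h7 := pow_le_pow_left₀ (abs_nonneg _) h6 2
    rw [sq_abs] at h7
    nlinarith [sq_nonneg ((y2 - y1) - ((x2 - y2) - (x1 - y1)))]
  refine (Finset.sum_le_sum hterm).trans ?_
  rw [← Finset.mul_sum, Finset.sum_add_distrib, ← Finset.mul_sum, Finset.sum_const, Nat.card_Ico,
    nsmul_eq_mul, Nat.add_sub_cancel_left,
    h.isRowCyclic.sum_window h.one_le (fun x => ((A k x.2 x.2).re - (A k x.1 x.1).re) ^ 2)]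
  have hsumk : ∑ i, (A k i i).re ≤ r * g := by
    obtain ⟨U, hU⟩ := h.diagonalized k
    rwa [hU.sum_diag]
  have h1 := sum_sq_sub_le (h.diag_mem k) h.bound_nonneg hr hrn hsumk
  have h2 : (m : ℝ) * (8 * d ^ 2 + 5 * (p ^ 2 + 6 * m * e ^ 2))
      ≤ 700 * m ^ 5 * (p ^ 2 + e ^ 2) := by
    have hd2 : d ^ 2 ≤ 2 * m ^ 2 * p ^ 2 + 72 * m ^ 4 * e ^ 2 := by
      rw [hd]
      nlinarith [sq_nonneg (m * p - 6 * m ^ 2 * e)]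
    have hm4 : (1 : ℝ) ≤ m ^ 4 := one_le_pow₀ hm1
    have hm24 : (m : ℝ) ^ 2 ≤ m ^ 4 := pow_le_pow_right₀ hm1 (by norm_num)
    have hm14 : (m : ℝ) ≤ m ^ 4 := le_self_pow₀ hm1 (by norm_num)
    have h3 := mul_le_mul_of_nonneg_right hm24 (sq_nonneg p)
    have h4 := mul_le_mul_of_nonneg_right hm4 (sq_nonneg p)
    have h5 := mul_le_mul_of_nonneg_right hm14 (sq_nonneg e)
    have h8 : (0 : ℝ) ≤ m ^ 4 * p ^ 2 := by positivity
    have h9 : (0 : ℝ) ≤ m ^ 4 * e ^ 2 := by positivity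
    have h6 : 8 * d ^ 2 + 5 * (p ^ 2 + 6 * m * e ^ 2) ≤ 700 * m ^ 4 * (p ^ 2 + e ^ 2) := by
      nlinarith
    calc (m : ℝ) * (8 * d ^ 2 + 5 * (p ^ 2 + 6 * m * e ^ 2))
        ≤ m * (700 * m ^ 4 * (p ^ 2 + e ^ 2)) := by gcongr
      _ = _ := by ring
  have h7 := mul_le_mul_of_nonneg_left (add_le_add (mul_le_mul_of_nonneg_left h1 zero_le_two) h2)
    (sq_nonneg η)
  refine h7.trans (le_of_eq ?_)
  rw [he]
  ring

end IsRotationSequence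

/-! ### The bound for one sweep -/

theorem gaps_spec {ev : Fin n → ℝ} {δ : ℝ} (h : IsLeast (gaps ev) (3 * δ)) :
    0 < δ ∧ ∀ i j, ev i ≠ ev j → 3 * δ ≤ |ev i - ev j| := by
  obtain ⟨i, j, hij, hδ⟩ := h.1
  refine ⟨?_, fun i j hij => h.2 ⟨i, j, hij, rfl⟩⟩
  have := abs_pos.2 (sub_ne_zero.2 hij)
  linarith

theorem le_of_gaps {ev : Fin n → ℝ} {δ g : ℝ} (h : IsLeast (gaps ev) (3 * δ))
    (hev : ∀ s, ev s ∈ Set.Icc 0 g) : δ ≤ g := by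
  obtain ⟨i, j, -, hδ⟩ := h.1
  have h1 : |ev i - ev j| ≤ g := by
    rw [abs_le]
    constructor <;> linarith [(hev i).1, (hev i).2, (hev j).1, (hev j).2]
  linarith [(gaps_spec h).1]

theorem maskedSq_zero (D : Fin n → Fin n → Prop) : maskedSq D 0 = 0 := by
  unfold maskedSq
  refine Finset.sum_eq_zero fun i _ => Finset.sum_eq_zero fun x _ => ?_
  split_ifs
  · rw [Matrix.zero_apply, norm_zero, zero_pow two_ne_zero]
  · rfl

/-- The combination of the bounds for the places between different classes (`E`) and inside a class
(`I`). -/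
theorem perturbative_arithmetic {n M N X c e E κ R I z η p P : ℝ} (hn : 1 ≤ n) (hM : 1 ≤ M)
    (hN : 1 ≤ N) (hc : 0 ≤ c) (hc' : c * (300 * M ^ 3 * n) = 1) (he : 0 ≤ e)
    (hκ0 : 0 ≤ κ) (hκ : κ ≤ 12 * X + 124 * M ^ 2 * c * e) (hR0 : 0 ≤ R)
    (hR : R ≤ 2 * N * e ^ 2 + 700 * M ^ 5 * η ^ 2 * (p ^ 2 + e ^ 2)) (hηc : η ≤ c) (hη : 0 ≤ η)
    (hp : 0 ≤ p) (hηp : η * p ≤ c * e) (hE0 : 0 ≤ E) (hE : Real.sqrt E ≤ M * (n * κ) + Real.sqrt (2 * R))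
    (hz0 : 0 ≤ z) (hz : z ≤ 4 * X + 36 * M ^ 2 * c * e) (hI : I ≤ n ^ 2 * z ^ 2)
    (hP : 2 * P ^ 2 = E + I) : P ^ 2 ≤ 2 / c ^ 2 * X ^ 2 + 4 * N * e ^ 2 := by
  have hM0 : 0 < M := by linarith
  have hn0 : 0 < n := by linarith
  have hcpos : 0 < c := lt_of_le_of_ne hc (by rintro rfl; simp at hc')
  have hc2 : c ^ 2 * (M ^ 6 * n ^ 2) = 1 / 90000 := by
    have : (c * (300 * M ^ 3 * n)) ^ 2 = 1 := by rw [hc', one_pow]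
    linear_combination this / 90000
  -- The weights 5 and 5/4 in (a + b)² keep the leading residual at 5/2 · N e² in P²; the distance
  -- to 4 N e² absorbs all terms with a factor `c`.
  have hE2 : E ≤ 5 * (M * (n * κ)) ^ 2 + 5 / 2 * R := by
    have h1 := pow_le_pow_left₀ (Real.sqrt_nonneg E) hE 2
    rw [Real.sq_sqrt hE0] at h1
    have h2 := Real.sq_sqrt (by linarith : 0 ≤ 2 * R)
    nlinarith [sq_nonneg (4 * (M * (n * κ)) - Real.sqrt (2 * R))]
  have hκ2 : κ ^ 2 ≤ 288 * X ^ 2 + 30752 * (M ^ 4 * (c * e) ^ 2) := by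
    have h1 := pow_le_pow_left₀ hκ0 hκ 2
    nlinarith [sq_nonneg (12 * X - 124 * M ^ 2 * c * e)]
  have hz2 : z ^ 2 ≤ 32 * X ^ 2 + 2592 * (M ^ 4 * (c * e) ^ 2) := by
    have h1 := pow_le_pow_left₀ hz0 hz 2
    nlinarith [sq_nonneg (4 * X - 36 * M ^ 2 * c * e)]
  have hηp2 : η ^ 2 * p ^ 2 ≤ (c * e) ^ 2 := by
    rw [← mul_pow]; exact pow_le_pow_left₀ (by positivity) hηp 2
  have hηe2 : η ^ 2 * e ^ 2 ≤ (c * e) ^ 2 := by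
    rw [← mul_pow]; exact pow_le_pow_left₀ (by positivity) (by gcongr) 2
  have hM2 : (1 : ℝ) ≤ M ^ 2 := one_le_pow₀ hM
  have hn2 : (1 : ℝ) ≤ n ^ 2 := one_le_pow₀ hn
  have a1 : M ^ 4 * n ^ 2 ≤ M ^ 6 * n ^ 2 := by gcongr; norm_num
  have a2 : M ^ 5 ≤ M ^ 6 * n ^ 2 := by
    calc M ^ 5 ≤ M ^ 6 := pow_le_pow_right₀ hM (by norm_num)
      _ ≤ M ^ 6 * n ^ 2 := le_mul_of_one_le_right (by positivity) hn2
  have a3 : M ^ 2 * n ^ 2 ≤ M ^ 6 * n ^ 2 := by gcongr; norm_num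
  have a4 : n ^ 2 ≤ M ^ 6 * n ^ 2 := le_mul_of_one_le_left (by positivity) (one_le_pow₀ hM)
  have b1 : M ^ 6 * n ^ 2 * (c * e) ^ 2 = e ^ 2 / 90000 := by
    linear_combination e ^ 2 * hc2
  have hC : 2 / c ^ 2 = 180000 * (M ^ 6 * n ^ 2) := by
    rw [div_eq_iff (by positivity)]
    linear_combination -180000 * hc2
  have t1 : (M * (n * κ)) ^ 2 ≤ 288 * (M ^ 6 * n ^ 2 * X ^ 2) + 30752 * (e ^ 2 / 90000) := by
    calc (M * (n * κ)) ^ 2 = M ^ 2 * n ^ 2 * κ ^ 2 := by ring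
      _ ≤ M ^ 2 * n ^ 2 * (288 * X ^ 2 + 30752 * (M ^ 4 * (c * e) ^ 2)) := by gcongr
      _ = 288 * (M ^ 2 * n ^ 2 * X ^ 2) + 30752 * (M ^ 6 * n ^ 2 * (c * e) ^ 2) := by ring
      _ ≤ 288 * (M ^ 6 * n ^ 2 * X ^ 2) + 30752 * (M ^ 6 * n ^ 2 * (c * e) ^ 2) := by gcongr
      _ = _ := by rw [b1]
  have t2 : I ≤ 32 * (M ^ 6 * n ^ 2 * X ^ 2) + 2592 * (e ^ 2 / 90000) := by
    calc I ≤ n ^ 2 * z ^ 2 := hI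
      _ ≤ n ^ 2 * (32 * X ^ 2 + 2592 * (M ^ 4 * (c * e) ^ 2)) := by gcongr
      _ = 32 * (n ^ 2 * X ^ 2) + 2592 * (M ^ 4 * n ^ 2 * (c * e) ^ 2) := by ring
      _ ≤ 32 * (M ^ 6 * n ^ 2 * X ^ 2) + 2592 * (M ^ 6 * n ^ 2 * (c * e) ^ 2) := by gcongr
      _ = _ := by rw [b1]
  have t3 : R ≤ 2 * N * e ^ 2 + 1400 * (e ^ 2 / 90000) := by
    calc R ≤ 2 * N * e ^ 2 + 700 * M ^ 5 * (η ^ 2 * p ^ 2 + η ^ 2 * e ^ 2) := by linarith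
      _ ≤ 2 * N * e ^ 2 + 700 * M ^ 5 * ((c * e) ^ 2 + (c * e) ^ 2) := by gcongr
      _ = 2 * N * e ^ 2 + 1400 * (M ^ 5 * (c * e) ^ 2) := by ring
      _ ≤ 2 * N * e ^ 2 + 1400 * (M ^ 6 * n ^ 2 * (c * e) ^ 2) := by gcongr
      _ = _ := by rw [b1]
  rw [hC]
  have u1 : 0 ≤ M ^ 6 * n ^ 2 * X ^ 2 := by positivity
  have u2 : e ^ 2 ≤ N * e ^ 2 := le_mul_of_one_le_left (sq_nonneg e) hN
  have u3 : 0 ≤ e ^ 2 := sq_nonneg e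
  linarith

namespace IsRotationSequence

variable {η g : ℝ} {J : ℕ → Fin n × Fin n} {ev : Fin n → ℝ} {k : ℕ}
  {A : ℕ → Matrix (Fin n) (Fin n) ℂ} {θ : ℕ → ℝ}

/-- Quadratic convergence, up to the residuals, if the off-diagonal part and the accuracy are small
compared to the gap. -/
theorem offNorm_sq_le_of_small (h : IsRotationSequence η g J ev k A θ) {r : ℕ} (hr : 0 < r)
    (hrn : r < n) (hev : ∑ s, ev s ≤ r * g) (hm : 1 ≤ sweepLength n) {δ c : ℝ}
    (hδ : IsLeast (gaps ev) (3 * δ)) (hc : 0 ≤ c)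
    (hc' : c * (300 * (sweepLength n : ℝ) ^ 3 * n) = 1) (hηc : η ≤ c)
    (hp : offNorm (A k) ≤ c * δ) (he : η * g ≤ c * δ)
    (hcl : Function.Injective ev ∨
      (sweepLength n ∣ k - 1 ∧ AffiliationConsecutive ev δ (A k))) :
    offNorm (A (k + sweepLength n)) ^ 2 ≤ 2 / c ^ 2 * (offNorm (A k) ^ 2 / δ) ^ 2
      + 4 * ((2 * n * r - r ^ 2 - r) / 2) * (η * g) ^ 2 := by
  obtain ⟨hδ0, hgap⟩ := gaps_spec hδ
  have hδg := le_of_gaps hδ h.mem_Icc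
  have hR := h.sum_pivot_sq_le hr hrn hev hm
  have hR0 : 0 ≤ ∑ q ∈ Finset.Ico k (k + sweepLength n), ‖A (q + 1) (J q).1 (J q).2‖ ^ 2 :=
    Finset.sum_nonneg fun _ _ => by positivity
  have hr1 : (1 : ℝ) ≤ r := by exact_mod_cast hr
  have hrn1 : (r : ℝ) + 1 ≤ n := by exact_mod_cast hrn
  have hn1 : (1 : ℝ) ≤ n := by linarith
  have hM1 : (1 : ℝ) ≤ sweepLength n := by exact_mod_cast hm
  have hN : 1 ≤ (2 * (n : ℝ) * r - r ^ 2 - r) / 2 := by nlinarith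
  have hη := h.eta_nonneg
  have hη1 := h.eta_le_one
  have hg := h.bound_nonneg
  have he0 : 0 ≤ η * g := mul_nonneg hη hg
  have hp0 := offNorm_nonneg (A k)
  have hpq : ∀ s ≤ sweepLength n,
      offNorm (A (k + s)) ≤ offNorm (A k) + 3 * sweepLength n * (η * g) :=
    fun s hs => h.offNorm_le hm hs
  have hdrift : ∀ s ≤ sweepLength n, ∀ i, |(A (k + s) i i).re - (A k i i).re|
      ≤ sweepLength n * offNorm (A k) + 6 * (sweepLength n : ℝ) ^ 2 * (η * g) :=
    fun s hs i => h.drift_le hm hs i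
  have hsep : 36 * (sweepLength n : ℝ) ^ 2 * c ≤ 1 := by
    rw [← hc']
    have : (sweepLength n : ℝ) ^ 2 ≤ sweepLength n ^ 3 * n := by
      calc (sweepLength n : ℝ) ^ 2 ≤ sweepLength n ^ 3 := pow_le_pow_right₀ hM1 (by norm_num)
        _ ≤ _ := le_mul_of_one_le_right (by positivity) hn1
    nlinarith [mul_le_mul_of_nonneg_left this hc, pow_pos (lt_of_lt_of_le one_pos hM1) 2]
  have hJ := h.isRowCyclic
  have hk := h.one_le
  set M : ℝ := (sweepLength n : ℝ) with hM
  set p := offNorm (A k) with hpdef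
  set e := η * g with hedef
  set N : ℝ := (2 * (n : ℝ) * r - r ^ 2 - r) / 2 with hNdef
  set P := p + 3 * M * e with hPdef
  have hP0 : 0 ≤ P := by positivity
  have hM2 : M ≤ M ^ 2 := le_self_pow₀ hM1 two_ne_zero
  have hcδ : M ^ 2 * (c * δ) ≤ δ / 36 := by nlinarith
  have hcδ1 : M * (c * δ) ≤ M ^ 2 * (c * δ) := by gcongr
  have hcδ2 : c * δ ≤ M * (c * δ) := le_mul_of_one_le_left (by positivity) hM1
  -- The class of a position is the value `ev (σ i)`, fixed at stage `k`; labelling by values rather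
  -- than indices merges the copies of a multiple eigenvalue.
  choose σ hσ using fun i => (h.diagonalized k).choose_spec.exists_abs_sub_le i
  rw [← hpdef] at hσ
  have hdiag : ∀ s ≤ sweepLength n, ∀ i, |(A (k + s) i i).re - ev (σ i)| ≤ δ / 3 := by
    intro s hs i
    have h1 := hdrift s hs i
    have h2 := hσ i
    rw [abs_sub_comm] at h2
    have h3 := _root_.abs_sub_le (A (k + s) i i).re (A k i i).re (ev (σ i))
    have h4 : M * p ≤ M * (c * δ) := by gcongr
    have h5 : M ^ 2 * e ≤ M ^ 2 * (c * δ) := by gcongr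
    linarith
  have hsame : ∀ i x, ev (σ i) ≠ ev (σ x) → 3 * δ ≤ |ev (σ i) - ev (σ x)| :=
    fun i x => hgap _ _
  have hclos : ∀ q, k ≤ q → q < k + sweepLength n → ev (σ (J q).1) = ev (σ (J q).2) →
      ∀ x, ev (σ x) ≠ ev (σ (J q).1) →
        (IsProcessed J k q x (J q).1 ↔ IsProcessed J k q x (J q).2) := by
    intro q hq hq' hs x hx
    -- Simple eigenvalues exclude pivots inside a class. Otherwise consecutive affiliation makes the
    -- classes intervals: two eigenvalues close to one diagonal entry coincide.
    rcases hcl with hinj | ⟨hdvd, hcons⟩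
    · obtain ⟨U, hU⟩ := h.diagonalized k
      have h1 := hdiag 0 (Nat.zero_le _) (J q).1
      have h2 := hdiag 0 (Nat.zero_le _) (J q).2
      rw [← hs] at h2
      exact absurd (hU.eq_of_same_of_injective hδ0 hinj (s₀ := σ (J q).1) (fun s => hgap s _)
        (by rw [← hpdef]; linarith) (h1.trans (by linarith)) (h2.trans (by linarith))) (h.ne hq)
    · refine hJ.isProcessed_iff_of_same (c := fun i => ev (σ i)) hk hdvd hq hq' ?_ hs hx
      intro i j x hij hjx hix
      have h1 := hdiag 0 (Nat.zero_le _) i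
      have h2 := hdiag 0 (Nat.zero_le _) x
      have h3 := hdiag 0 (Nat.zero_le _) j
      rw [add_zero] at h1 h2 h3
      have hix' : ev (σ i) = ev (σ x) := hix
      rw [← hix'] at h2
      have h4 := hcons i j x (σ i) hij hjx (h1.trans (by linarith)) (h2.trans (by linarith))
      by_contra hne
      have h5 := hgap _ _ hne
      rw [abs_sub_comm] at h3
      have h6 := _root_.abs_sub_le (ev (σ j)) (A k j j).re (ev (σ i))
      linarith
  have hsin : ∀ q, k ≤ q → q < k + sweepLength n → ev (σ (J q).1) ≠ ev (σ (J q).2) →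
      2 * |Real.sin (θ q)| * P ≤ 2 * (3 * P / δ + 2 * η) * P := by
    intro q hq hq' hne
    refine mul_le_mul_of_nonneg_right ?_ hP0
    refine mul_le_mul_of_nonneg_left ?_ zero_le_two
    obtain ⟨s, rfl⟩ := Nat.exists_eq_add_of_le hq
    have hs : s ≤ sweepLength n := by omega
    have h1 := (h.step _ hq).abs_mul_abs_sin_le (h.ne hq) hη (h.isHermitian _)
    have h2 := (norm_apply_le_offNorm (h.isHermitian (k + s)) (h.ne hq)).trans (hpq s hs)
    have h3 := hdiag s hs (J (k + s)).1
    have h4 := hdiag s hs (J (k + s)).2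
    have h5 := hsame _ _ hne
    set a1 := (A (k + s) (J (k + s)).1 (J (k + s)).1).re
    set a2 := (A (k + s) (J (k + s)).2 (J (k + s)).2).re
    set b := ‖A (k + s) (J (k + s)).1 (J (k + s)).2‖
    -- The eigenvalues differ by at least 3δ, and each diagonal entry is within δ/3 of its own.
    have h6 : 2 * δ ≤ |a2 - a1| := by
      have e1 : |ev (σ (J (k + s)).1) - ev (σ (J (k + s)).2)| ≤
          |ev (σ (J (k + s)).1) - a1| + |a1 - a2| + |a2 - ev (σ (J (k + s)).2)| := by
        refine (_root_.abs_sub_le _ a1 _).trans ?_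
        linarith [_root_.abs_sub_le a1 a2 (ev (σ (J (k + s)).2))]
      rw [abs_sub_comm _ a1, abs_sub_comm a1 a2] at e1
      linarith
    by_cases h7 : |Real.sin (θ (k + s))| ≤ 2 * η
    · exact h7.trans (le_add_of_nonneg_left (by positivity))
    · rw [not_le] at h7
      have h8 : |Real.sin (θ (k + s))| - 2 * η ≤ 3 * P / δ := by
        rw [le_div_iff₀ hδ0]
        have h9 : 2 * δ * (|Real.sin (θ (k + s))| - 2 * η)
            ≤ |a2 - a1| * (|Real.sin (θ (k + s))| - 2 * η) :=
          mul_le_mul_of_nonneg_right h6 (by linarith)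
        have h10 : η * b ≤ 1 * P := mul_le_mul hη1 h2 (norm_nonneg _) zero_le_one
        linarith
      linarith
  have hE := sqrt_maskedSq_processed_le hJ hk h.isHermitian h.step
    (c := fun i => ev (σ i)) (m := sweepLength n) hclos (p := P)
    (κ := 2 * (3 * P / δ + 2 * η) * P) (by positivity)
    (fun q hq hq' => by
      obtain ⟨s, rfl⟩ := Nat.exists_eq_add_of_le hq
      exact hpq s (by omega)) hsin (sweepLength n) le_rfl
  have hP2 : P ^ 2 / δ ≤ 2 * (p ^ 2 / δ) + 18 * M ^ 2 * c * e := by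
    have h1 : e ^ 2 / δ ≤ c * e := by
      rw [div_le_iff₀ hδ0, sq]
      calc e * e ≤ e * (c * δ) := by gcongr
        _ = _ := by ring
    have h2 : P ^ 2 ≤ 2 * p ^ 2 + 18 * M ^ 2 * e ^ 2 := by
      rw [hPdef]; nlinarith [sq_nonneg (p - 3 * M * e)]
    calc P ^ 2 / δ ≤ (2 * p ^ 2 + 18 * M ^ 2 * e ^ 2) / δ := by gcongr
      _ = 2 * (p ^ 2 / δ) + 18 * M ^ 2 * (e ^ 2 / δ) := by ring
      _ ≤ 2 * (p ^ 2 / δ) + 18 * M ^ 2 * (c * e) := by gcongr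
      _ = _ := by ring
  have hηp : η * p ≤ c * e := by
    calc η * p ≤ η * (c * δ) := by gcongr
      _ = c * (η * δ) := by ring
      _ ≤ c * (η * g) := by gcongr
  have hκ : 2 * (3 * P / δ + 2 * η) * P ≤ 12 * (p ^ 2 / δ) + 124 * M ^ 2 * c * e := by
    have h1 : η * e ≤ c * e := by gcongr
    have h2 : η * P ≤ c * e + 3 * M * (c * e) := by
      rw [hPdef, mul_add]
      have : η * (3 * M * e) = 3 * M * (η * e) := by ring
      rw [this]
      gcongr
    have h3 : c * e ≤ M ^ 2 * (c * e) := le_mul_of_one_le_left (by positivity) (one_le_pow₀ hM1)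
    have h4 : M * (c * e) ≤ M ^ 2 * (c * e) := by gcongr
    have h5 : 2 * (3 * P / δ + 2 * η) * P = 6 * (P ^ 2 / δ) + 4 * (η * P) := by ring
    rw [h5]
    linarith
  -- After a full sweep every off-diagonal place is either inside a class or a processed place
  -- between classes.
  have hcov : 2 * offNorm (A (k + sweepLength n)) ^ 2
      = maskedSq (fun i x => ev (σ i) ≠ ev (σ x) ∧ IsProcessed J k (k + sweepLength n) i x)
          (A (k + sweepLength n))
        + maskedSq (fun i x => i ≠ x ∧ ev (σ i) = ev (σ x)) (A (k + sweepLength n)) := by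
    rw [two_mul_offNorm_sq (h.isHermitian _), ← maskedSq_or (fun i x h h' => h.1 h'.2)]
    refine maskedSq_congr (fun i x => ?_) _
    constructor
    · intro hix
      by_cases hs : ev (σ i) = ev (σ x)
      · exact Or.inr ⟨hix, hs⟩
      · exact Or.inl ⟨hs, hJ.isProcessed_sweep hk hix⟩
    · rintro (⟨h1, -⟩ | ⟨h1, -⟩)
      · rintro rfl; exact h1 rfl
      · exact h1
  have hintra : maskedSq (fun i x => i ≠ x ∧ ev (σ i) = ev (σ x)) (A (k + sweepLength n))
      ≤ (n : ℝ) ^ 2 * (2 * P ^ 2 / δ) ^ 2 := by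
    obtain ⟨U, hU⟩ := h.diagonalized (k + sweepLength n)
    -- Comparison with the zero matrix turns the perturbation lemma into a bound for uniformly small
    -- entries.
    refine (maskedSq_le_of_norm_le (A := 0) (κ := 2 * P ^ 2 / δ) (by positivity) ?_).trans
      (le_of_eq ?_)
    · rintro i x ⟨hix, hs⟩
      have h1 := hdiag _ le_rfl i
      have h2 := hdiag _ le_rfl x
      rw [← hs] at h2
      have h3 := hU.norm_apply_le_of_same hδ0 (lam := ev (σ i)) (fun s => hgap s _) hix
        (h1.trans (by linarith)) (h2.trans (by linarith))
      have h4 := pow_le_pow_left₀ (offNorm_nonneg _) (hpq _ le_rfl) 2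
      simp only [Matrix.zero_apply, norm_zero, zero_add]
      refine h3.trans ?_
      gcongr
    · rw [maskedSq_zero, Real.sqrt_zero, zero_add, mul_pow]
  refine perturbative_arithmetic (n := n) (M := M) (R := ∑ q ∈ Finset.Ico k (k + sweepLength n),
    ‖A (q + 1) (J q).1 (J q).2‖ ^ 2) (z := 2 * P ^ 2 / δ) (p := p) hn1 hM1 hN hc hc' he0
    (by positivity) hκ hR0 ?_ hηc hη hp0 hηp (maskedSq_nonneg _ _) hE (by positivity) ?_ hintra hcov
  · refine hR.trans (le_of_eq ?_)
    rw [hNdef]; ring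
  · have : 2 * P ^ 2 / δ = 2 * (P ^ 2 / δ) := by ring
    rw [this]; linarith

/-- The bound for one sweep. -/
theorem offNorm_sq_sweep_le (h : IsRotationSequence η g J ev k A θ) {r : ℕ} (hr : 0 < r)
    (hrn : r < n) (hev : ∑ s, ev s ≤ r * g) (hm : 1 ≤ sweepLength n) {δ c : ℝ}
    (hδ : IsLeast (gaps ev) (3 * δ)) (hc : 0 < c)
    (hc' : c * (300 * (sweepLength n : ℝ) ^ 3 * n) = 1) (hηc : η ≤ c)
    (hcl : Function.Injective ev ∨
      (sweepLength n ∣ k - 1 ∧ AffiliationConsecutive ev δ (A k))) :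
    offNorm (A (k + sweepLength n)) ^ 2 ≤ 2 / c ^ 2 * (offNorm (A k) ^ 2 / δ) ^ 2
      + 4 * ((2 * n * r - r ^ 2 - r) / 2) * (η * g) ^ 2 := by
  by_cases hsmall : offNorm (A k) ≤ c * δ ∧ η * g ≤ c * δ
  · exact h.offNorm_sq_le_of_small hr hrn hev hm hδ hc.le hc' hηc hsmall.1 hsmall.2 hcl
  obtain ⟨hδ0, -⟩ := gaps_spec hδ
  have hr1 : (1 : ℝ) ≤ r := by exact_mod_cast hr
  have hrn1 : (r : ℝ) + 1 ≤ n := by exact_mod_cast hrn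
  have hn1 : (1 : ℝ) ≤ n := by linarith
  have hM1 : (1 : ℝ) ≤ sweepLength n := by exact_mod_cast hm
  have hN : 1 ≤ (2 * (n : ℝ) * r - r ^ 2 - r) / 2 := by nlinarith
  have hp0 := offNorm_nonneg (A k)
  have he0 : 0 ≤ η * g := mul_nonneg h.eta_nonneg h.bound_nonneg
  have h1 := (h.offNorm_sq_le (sweepLength n)).trans
    (add_le_add_right (h.sum_pivot_sq_le hr hrn hev hm) _)
  set M : ℝ := (sweepLength n : ℝ) with hM
  set p := offNorm (A k)
  set e := η * g
  set N : ℝ := (2 * (n : ℝ) * r - r ^ 2 - r) / 2 with hNdef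
  have hB : 700 * M ^ 5 * η ^ 2 ≤ 1 / 2 := by
    have h2 : η ^ 2 ≤ c ^ 2 := pow_le_pow_left₀ h.eta_nonneg hηc 2
    have h3 : c ^ 2 * (M ^ 6 * n ^ 2) = 1 / 90000 := by
      have : (c * (300 * M ^ 3 * n)) ^ 2 = 1 := by rw [hc', one_pow]
      linear_combination this / 90000
    have h4 : M ^ 5 ≤ M ^ 6 * n ^ 2 := by
      calc M ^ 5 ≤ M ^ 6 := pow_le_pow_right₀ hM1 (by norm_num)
        _ ≤ M ^ 6 * n ^ 2 := le_mul_of_one_le_right (by positivity) (one_le_pow₀ hn1)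
    calc 700 * M ^ 5 * η ^ 2 ≤ 700 * (M ^ 6 * n ^ 2) * c ^ 2 := by gcongr
      _ = 700 * (c ^ 2 * (M ^ 6 * n ^ 2)) := by ring
      _ ≤ 1 / 2 := by rw [h3]; norm_num
  have h2 : 700 * M ^ 5 * η ^ 2 * (p ^ 2 + e ^ 2) ≤ 1 / 2 * (p ^ 2 + e ^ 2) := by gcongr
  have h3 : (2 * (n : ℝ) * r - r ^ 2 - r) * e ^ 2 = 2 * (N * e ^ 2) := by rw [hNdef]; ring
  have h4 : e ^ 2 ≤ N * e ^ 2 := le_mul_of_one_le_left (sq_nonneg e) hN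
  rw [h3] at h1
  -- Outside the perturbative regime the growth bound P'² ≤ 3p²/2 + 2N e² + e²/2 is enough: p² is at
  -- most e² in the first case and at most c⁻²(p²/δ)² in the second.
  by_cases hp : p ≤ c * δ
  · have he : c * δ < e := by
      by_contra hcon
      exact hsmall ⟨hp, not_lt.1 hcon⟩
    have h5 : p ^ 2 ≤ e ^ 2 := pow_le_pow_left₀ hp0 (hp.trans he.le) 2
    have h6 : 0 ≤ 2 / c ^ 2 * (p ^ 2 / δ) ^ 2 := by positivity
    linarith
  · rw [not_le] at hp
    have h5 : 2 * p ^ 2 ≤ 2 / c ^ 2 * (p ^ 2 / δ) ^ 2 := by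
      have h6 : (c * δ) ^ 2 ≤ p ^ 2 := pow_le_pow_left₀ (by positivity) hp.le 2
      have h7 : 2 / c ^ 2 * (p ^ 2 / δ) ^ 2 = 2 * (p ^ 2 * p ^ 2) / (c * δ) ^ 2 := by
        field_simp
      rw [h7, le_div_iff₀ (by positivity)]
      nlinarith [mul_le_mul_of_nonneg_left h6 (sq_nonneg p)]
    have h6 := sq_nonneg p
    have h7 := sq_nonneg e
    linarith

end IsRotationSequence

/-! ### Application to the algorithm -/

/-- A run of the algorithm on `Hᴴ * H` is a sequence of approximately annihilating rotations. -/
theorem IsRun.exists_isRotationSequence {r : ℕ} {H : Matrix (Fin r) (Fin n) ℂ} {f : ℕ → ℝ → ℝ}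
    (hf : ∀ k, IsObservation (f k)) {η : ℝ} (hη : 0 ≤ η) (hη1 : η ≤ 1) {J : ℕ → Fin n × Fin n}
    (hJ : IsRowCyclic J) {W : ℕ → Matrix (Fin n) (Fin n) ℂ} (hW : IsRun (Hᴴ * H) f η J W) {k : ℕ}
    (hk : 1 ≤ k) :
    ∃ θ, IsRotationSequence η (specNorm (Hᴴ * H)) J
      (isHermitian_conjTranspose_mul_self H).eigenvalues k (iterate (Hᴴ * H) W) θ := by
  have hpsd : (Hᴴ * H).PosSemidef := posSemidef_conjTranspose_mul_self H
  have hstep : ∀ q, ∃ θ, k ≤ q → IsApproxRotation η (J q).1 (J q).2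
      (iterate (Hᴴ * H) W q) (iterate (Hᴴ * H) W (q + 1)) θ := by
    intro q
    by_cases hq : k ≤ q
    · obtain ⟨θ, hθ⟩ := hW.isApproxRotation hpsd hf hJ (hk.trans hq)
      exact ⟨θ, fun _ => hθ⟩
    · exact ⟨0, fun h => absurd h hq⟩
  choose θ hθ using hstep
  exact ⟨θ, {
    eta_nonneg := hη
    eta_le_one := hη1
    bound_nonneg := specNorm_nonneg _
    one_le := hk
    isRowCyclic := hJ
    mem_Icc := fun s => ⟨hpsd.eigenvalues_nonneg s, eigenvalues_le_specNorm _ s⟩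
    diagonalized := fun q => hW.exists_isDiagonalizedBy _ hJ q
    step := hθ }⟩

theorem sum_eigenvalues_conjTranspose_mul_self_le {r : ℕ} (H : Matrix (Fin r) (Fin n) ℂ) :
    ∑ i, (isHermitian_conjTranspose_mul_self H).eigenvalues i ≤ H.rank * specNorm (Hᴴ * H) := by
  rw [← rank_conjTranspose_mul_self]
  exact sum_eigenvalues_le _

end BNSL

theorem theorem5 (nt nr : ℕ) (hr : 0 < nr) (hrt : nr < nt) :
    ∃ C η₀ : ℝ, 0 < C ∧ 0 < η₀ ∧
      ∀ (H : Matrix (Fin nr) (Fin nt) ℂ), H.rank = nr →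
      ∀ (f : ℕ → ℝ → ℝ), (∀ k, BNSL.IsObservation (f k)) →
      ∀ (J : ℕ → Fin nt × Fin nt), BNSL.IsRowCyclic J →
      ∀ (η : ℝ), 0 ≤ η → η ≤ η₀ →
      ∀ (W : ℕ → Matrix (Fin nt) (Fin nt) ℂ), BNSL.IsRun (H.conjTranspose * H) f η J W →
      ∀ (ev : Fin nt → ℝ),
        ev = (Matrix.isHermitian_conjTranspose_mul_self H).eigenvalues →
      ∀ (δ : ℝ), IsLeast (BNSL.gaps ev) (3 * δ) →
      ∀ (P : ℕ → ℝ),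
        (∀ k, P k = BNSL.offNorm (BNSL.iterate (H.conjTranspose * H) W k)) →
      ∀ (k : ℕ), 1 ≤ k →
        (Function.Injective ev ∨
          (BNSL.sweepLength nt ∣ k - 1 ∧
            BNSL.AffiliationConsecutive ev δ (BNSL.iterate (H.conjTranspose * H) W k))) →
        P k ^ 2 < δ ^ 2 / 8 →
        P (k + BNSL.sweepLength nt) ^ 2 ≤
          C * (P k ^ 2 / δ) ^ 2
            + C * (η * P k ^ (3 / 2 : ℝ) / δ)
            + C * (η ^ 2 * P k ^ (1 / 2 : ℝ) / δ)
            + 2 * (2 * (nt : ℝ) * (nr : ℝ) - (nr : ℝ) ^ 2 - (nr : ℝ)) * η ^ 2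
                * BNSL.specNorm (H.conjTranspose * H) ^ 2 := by
  have hm : 1 ≤ BNSL.sweepLength nt := by
    unfold BNSL.sweepLength
    rw [Nat.le_div_iff_mul_le two_pos]
    calc 1 * 2 = 2 * 1 := rfl
      _ ≤ nt * (nt - 1) := Nat.mul_le_mul (by omega) (by omega)
  have hM1 : (1 : ℝ) ≤ BNSL.sweepLength nt := by exact_mod_cast hm
  have hn1 : (1 : ℝ) ≤ nt := by exact_mod_cast (by omega : 1 ≤ nt)
  have hpos : 0 < 300 * (BNSL.sweepLength nt : ℝ) ^ 3 * nt := by positivity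
  -- One constant, depending only on `nt`, serves as accuracy threshold η₀ and as the limit of the
  -- perturbative regime; C = 2/c² then covers the case where P exceeds cδ.
  set c : ℝ := (300 * (BNSL.sweepLength nt : ℝ) ^ 3 * nt)⁻¹ with hc
  have hc0 : 0 < c := inv_pos.2 hpos
  have hc1 : c ≤ 1 := by
    refine inv_le_one_of_one_le₀ ?_
    have := one_le_pow₀ (n := 3) hM1
    nlinarith
  refine ⟨2 / c ^ 2, c, by positivity, hc0, ?_⟩
  rintro H hH f hf J hJ η hη hηc W hW ev rfl δ hδ P hP k hk hcl -
  obtain ⟨θ, hseq⟩ := hW.exists_isRotationSequence hf hη (hηc.trans hc1) hJ hk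
  have hsum := BNSL.sum_eigenvalues_conjTranspose_mul_self_le H
  rw [hH] at hsum
  have key := hseq.offNorm_sq_sweep_le hr hrt hsum hm hδ hc0 (inv_mul_cancel₀ hpos.ne') hηc hcl
  rw [← hP, ← hP] at key
  have hPk : 0 ≤ P k := by rw [hP]; exact BNSL.offNorm_nonneg _
  have hδ0 := (BNSL.gaps_spec hδ).1
  -- The two mixed terms are nonnegative and only enlarge a bound already proved.
  have h1 : 0 ≤ 2 / c ^ 2 * (η * P k ^ (3 / 2 : ℝ) / δ) := by positivity
  have h2 : 0 ≤ 2 / c ^ 2 * (η ^ 2 * P k ^ (1 / 2 : ℝ) / δ) := by positivity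
  linarith
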